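/- **Setting.** Let $\Lambda=\mathbb T^3$, $\mathbb T=\mathbb R/2\pi\mathbb Z$, with normalized (probability) Haar measure. For $k\ge 1$ a density matrix of order $k$ is a function $\sigma\in L^2(\Lambda^k\times\Lambda^k)$; for $\vec\xi=(\xi_1,\dots,\xi_k)$, $\vec\xi'=(\xi_1',\dots,\xi_k')\in(\mathbb Z^3)^k$ its Fourier coefficient is $$\widehat\sigma(\vec\xi;\vec\xi')=\int_{\Lambda^k\times\Lambda^k}\sigma(\vec x;\vec x')\,e^{-i\sum_j\langle x_j,\xi_j\rangle+i\sum_j\langle x'_j,\xi'_j\rangle}\,d\vec x\,d\vec x'.$$ With $\langle\zeta\rangle=\sqrt{1+|\zeta|^2}$, let $\|\sigma\|_{H^\alpha}$ be the $\ell^2$ norm of $\prod_j\langle\xi_j\rangle^\alpha\langle\xi'_j\rangle^\alpha\,\widehat\sigma(\vec\xi;\vec\xi')$, and let $\mathcal U^{(k)}(t)$ be the Fourier multiplier with symbol $e^{-it(\sum_j|\xi_j|^2-\sum_j|\xi'_j|^2)}$. For sequences $\Sigma=(\sigma^{(k)})_{k\ge1}$ of density matrices (respectively of random density matrices $\sigma^{(k)}\in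 L^2(\Omega;L^2(\Lambda^k\times\Lambda^k))$) put $$\|\Sigma\|_{\mathcal H^\alpha_\xi}=\sum_{k\ge1}\xi^k\|\sigma^{(k)}\|_{H^\alpha},\qquad \|\Sigma\|_{L^2(\Omega)\mathcal H^\alpha_\xi}=\sum_{k\ge1}\xi^k\,\big\|\,\|\sigma^{(k)}\|_{H^\alpha}\big\|_{L^2(\Omega)}.$$ $\Gamma\in C_{t\in[0,T]}L^2(\Omega)\mathcal H^\alpha_\xi$ means that $t\mapsto\Gamma(t)$ is continuous on $[0,T]$ in the latter norm (which is finite on each $\Gamma(t)$). Let $(h_\zeta)_{\zeta\in\mathbb Z^3}$ be independent random variables on a probability space $\Omega$, each equal to $\pm1$ with probability $\tfrac12$. The randomized collision operator is $[B^{(k+1)}]^\omega=\sum_{j=1}^k\big([B^+_{j,k+1}]^\omega-[B^-_{j,k+1}]^\omega\big)$, where $$([B^+_{j,k+1}]^\omega\sigma)^\wedge(\vec\xi;\vec\xi')=\sum_{a,b\in\mathbb Z^3}h_{\xi_j}h_{\xi_j-a+b}h_ah_b(\omega)\;\widehat\sigma(\xi_1,\dots,\xi_j-a+b,\dots,\xi_k,a;\vec\xi',b),$$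 $$([B^-_{j,k+1}]^\omega\sigma)^\wedge(\vec\xi;\vec\xi')=\sum_{a,b\in\mathbb Z^3}h_{\xi'_j}h_{\xi'_j-b+a}h_ah_b(\omega)\;\widehat\sigma(\vec\xi,a;\xi'_1,\dots,\xi'_j-b+a,\dots,\xi'_k,b).$$ The series are understood as unconditionally convergent in $L^2(\Omega)$; $[B^\pm_{j,k+1}]^\omega\sigma$ is defined if they converge for all $(\vec\xi;\vec\xi')$ and are the Fourier coefficients of an element of $L^2(\Omega;L^2(\Lambda^k\times\Lambda^k))$. Write $[\widehat B]^\omega\Sigma=([B^{(k+1)}]^\omega\sigma^{(k+1)})_{k\ge1}$ and $\mathcal U(t)\Sigma=(\mathcal U^{(k)}(t)\sigma^{(k)})_{k\ge1}$. For fixed $\alpha\ge0$, the non-resonant class $\mathcal N$ consists of the sequences $(\sigma^{(m)})_{m\ge1}$ such that, for all $m$, $\widehat\sigma^{(m)}(\vec\xi;\vec\xi')=0$ unless $|\xi_1|>\dots>|\xi_m|>|\xi'_1|>\dots>|\xi'_m|$, and such that for some $M>0$, $\|\sigma^{(m)}\|_{H^\alpha}\le M^m$ for all $m$. **Theorem.**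 Let $\alpha_0>\alpha\ge0$. There are constants $\widetilde C_1,\widetilde C_2>0$ depending only on $\alpha,\alpha_0$ such that the following holds whenever $0<\xi<\xi'$ and $T>0$ satisfy $$\frac{\widetilde C_1T}{\xi'}<1,\qquad \frac{\widetilde C_2\xi}{\xi'}<1.$$ For every (deterministic) $\Gamma(0)\in\mathcal H^{\alpha_0}_{\xi'}\cap\mathcal N$ there is $[\Gamma]^\omega\in C_{t\in[0,T]}L^2(\Omega)\mathcal H^\alpha_\xi$ such that $[\widehat B]^\omega[\Gamma]^\omega(t)$ is defined for every $t\in[0,T]$, each component of $s\mapsto\mathcal U(t-s)[\widehat B]^\omega[\Gamma]^\omega(s)$ is Bochner integrable on $[0,t]$, and, for all $t\in[0,T]$ and all $\xi_0>0$, $$\Big\|[\Gamma]^\omega(t)-\mathcal U(t)\Gamma(0)+i\int_0^t\mathcal U(t-s)[\widehat B]^\omega[\Gamma]^\omega(s)\,ds\Big\|_{L^2(\Omega)\mathcal H^\alpha_{\xi_0}}=0 .$$ In particular, for all $t\in[0,T]$ and all $k\ge1$, the order-$k$ component of the expression inside the norm has zero $L^2(\Omega)H^\alpha(\Lambda^k\times\Lambda^k)$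 norm. Moreover $$\sup_{t\in[0,T]}\|[\Gamma]^\omega(t)\|_{L^2(\Omega)\mathcal H^\alpha_\xi}\le C\,\|\Gamma(0)\|_{\mathcal H^\alpha_{\xi'}}$$ with a constant $C$ depending only on $\xi,\xi',\alpha,\alpha_0$. -/

import Mathlib

open MeasureTheory ProbabilityTheory Filter Topology
open scoped ENNReal NNReal

noncomputable section

namespace GP

/-! ### Frequencies and density matrices -/

/-- Frequencies for the spatial domain `𝕋³`. -/
abbrev Freq : Type := Fin 3 → ℤ

/-- The square `|ζ|²` of the Euclidean length of a frequency. -/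
def freqSq (ζ : Freq) : ℝ := ∑ c, (ζ c : ℝ) ^ 2

/-- The Euclidean length `|ζ|` of a frequency. -/
def freqNorm (ζ : Freq) : ℝ := Real.sqrt (freqSq ζ)

/-- The Japanese bracket `⟨ζ⟩ = √(1 + |ζ|²)`. -/
def bracket (ζ : Freq) : ℝ := Real.sqrt (1 + freqSq ζ)

/-- Coordinates of `Λᵏ × Λᵏ`, `Λ = 𝕋³`: `(Sum.inl j, c)` is the `c`-th coordinate of `x_j`,
`(Sum.inr j, c)` is the `c`-th coordinate of `x'_j`. -/
abbrev Coord (k : ℕ) : Type := (Fin k ⊕ Fin k) × Fin 3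

/-- The Haar probability measure on the torus `Λᵏ × Λᵏ`. -/
abbrev torusMeasure (k : ℕ) : Measure (UnitAddTorus (Coord k)) :=
  Measure.pi fun _ => AddCircle.haarAddCircle

/-- (Square integrable) density matrices of order `k` on `𝕋³`, i.e. elements of `L²(Λᵏ × Λᵏ)`.
The torus `𝕋 = ℝ/2πℤ` is parametrized by `ℝ/ℤ` through `x = 2π y`, and carries the Haar
probability measure, so that `e^{i x n}` becomes `fourier n y`. -/
abbrev DensityMatrix (k : ℕ) : Type :=
  Lp ℂ 2 (torusMeasure k)

/-- The Hilbert basis of `L²(Λᵏ × Λᵏ)` that consists of the characters. -/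
def characterBasis (k : ℕ) : HilbertBasis (Coord k → ℤ) ℂ (DensityMatrix k) :=
  UnitAddTorus.mFourierBasis

/-- The exponent of the character `e^{i ∑ ⟨x_j, ξ_j⟩ - i ∑ ⟨x'_j, ξ'_j⟩}`. -/
def signedFreq {k : ℕ} (ξ ξ' : Fin k → Freq) : Coord k → ℤ :=
  fun p => Sum.elim (fun j => ξ j p.2) (fun j => -ξ' j p.2) p.1

/-- The Fourier coefficient `σ̂(ξ; ξ')` of a density matrix: the integral of
`σ(x; x') e^{-i ∑ ⟨x_j, ξ_j⟩ + i ∑ ⟨x'_j, ξ'_j⟩}` over `Λᵏ × Λᵏ`. -/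
def fourierCoef {k : ℕ} (σ : DensityMatrix k) (ξ ξ' : Fin k → Freq) : ℂ :=
  ∫ x, UnitAddTorus.mFourier (-signedFreq ξ ξ') x * σ x ∂torusMeasure k

theorem characterBasis_repr {k : ℕ} (σ : DensityMatrix k) (ξ ξ' : Fin k → Freq) :
    (characterBasis k).repr σ (signedFreq ξ ξ') = fourierCoef σ ξ ξ' :=
  UnitAddTorus.mFourierBasis_repr σ (signedFreq ξ ξ')

/-- A density matrix is determined by its Fourier coefficients. -/
theorem fourierCoef_ext {k : ℕ} {σ τ : DensityMatrix k}
    (hστ : ∀ ξ ξ', fourierCoef σ ξ ξ' = fourierCoef τ ξ ξ') : σ = τ := by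
  apply (characterBasis k).repr.injective
  ext n
  have hn : signedFreq (fun j c => n (Sum.inl j, c)) (fun j c => -n (Sum.inr j, c)) = n := by
    funext p
    rcases p with ⟨j | j, c⟩ <;> simp [signedFreq]
  have := hστ (fun j c => n (Sum.inl j, c)) (fun j c => -n (Sum.inr j, c))
  rwa [← characterBasis_repr, ← characterBasis_repr, hn] at this

/-! ### The free evolution -/

/-- Multiplication by a sequence of complex numbers of modulus one, as an isometry of `ℓ²`. -/
def unimodularMul {ι : Type*} (φ : ι → ℂ) (hφ : ∀ i, ‖φ i‖ = 1) :
    lp (fun _ : ι => ℂ) 2 →ₗᵢ[ℂ] lp (fun _ : ι => ℂ) 2 where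
  toFun f := ⟨fun i => φ i * f i, by
    have h := lp.memℓp f
    rw [memℓp_gen_iff (by norm_num)] at h
    exact (memℓp_gen_iff (by norm_num)).2 (by simpa [hφ] using h)⟩
  map_add' f g := by
    ext i
    exact mul_add _ _ _
  map_smul' c f := by
    ext i
    exact mul_left_comm _ _ _
  norm_map' f := by
    rw [lp.norm_eq_tsum_rpow (by norm_num), lp.norm_eq_tsum_rpow (by norm_num)]
    simp [hφ]

/-- The symbol `|ξ_1|² + ⋯ + |ξ_k|² - |ξ'_1|² - ⋯ - |ξ'_k|²` of `-(Δ_x - Δ_{x'})`, read off from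
the exponent of a character. -/
def laplaceSymbol {k : ℕ} (n : Coord k → ℤ) : ℝ :=
  (∑ j, freqSq fun c => n (Sum.inl j, c)) - ∑ j, freqSq fun c => n (Sum.inr j, c)

/-- The free evolution `U⁽ᵏ⁾(t) σ = e^{it ∑ Δ_{x_j}} σ e^{-it ∑ Δ_{x'_j}}` on density matrices of
order `k`: the Fourier multiplier with symbol `e^{-it(|ξ|² - |ξ'|²)}`. -/
def freeEvolution (k : ℕ) (t : ℝ) : DensityMatrix k →L[ℂ] DensityMatrix k :=
  ((characterBasis k).repr.symm.toLinearIsometry.comp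
    ((unimodularMul (fun n : Coord k → ℤ => Complex.exp ((-(t * laplaceSymbol n) : ℝ) * Complex.I))
      (fun _ => Complex.norm_exp_ofReal_mul_I _)).comp
      (characterBasis k).repr.toLinearIsometry)).toContinuousLinearMap

theorem fourierCoef_freeEvolution {k : ℕ} (t : ℝ) (σ : DensityMatrix k) (ξ ξ' : Fin k → Freq) :
    fourierCoef (freeEvolution k t σ) ξ ξ' =
      Complex.exp ((-(t * ((∑ j, freqSq (ξ j)) - ∑ j, freqSq (ξ' j))) : ℝ) * Complex.I) *
        fourierCoef σ ξ ξ' := by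
  have h : laplaceSymbol (signedFreq ξ ξ') = (∑ j, freqSq (ξ j)) - ∑ j, freqSq (ξ' j) := by
    simp [laplaceSymbol, signedFreq, freqSq]
  rw [← h, ← characterBasis_repr, ← characterBasis_repr]
  simp [freeEvolution, unimodularMul]

/-! ### Sobolev norms and deterministic hierarchies -/

/-- The weight `⟨ξ_1⟩^α ⋯ ⟨ξ_k⟩^α ⟨ξ'_1⟩^α ⋯ ⟨ξ'_k⟩^α` of the operator `S^{(k,α)}`. -/
def sobolevWeight {k : ℕ} (α : ℝ) (ξ ξ' : Fin k → Freq) : ℝ :=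
  (∏ j, bracket (ξ j) ^ α) * ∏ j, bracket (ξ' j) ^ α

/-- `‖σ‖_{H^α(Λᵏ × Λᵏ)} = ‖S^{(k,α)} σ‖_{L²(Λᵏ × Λᵏ)}`, computed by Plancherel's theorem; the
value is `∞` if `σ` is not in `H^α`. -/
def sobolevNorm {k : ℕ} (α : ℝ) (σ : DensityMatrix k) : ℝ≥0∞ :=
  (∑' p : (Fin k → Freq) × (Fin k → Freq),
    (ENNReal.ofReal (sobolevWeight α p.1 p.2) * ‖fourierCoef σ p.1 p.2‖ₑ) ^ 2) ^ (1 / 2 : ℝ)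

/-- Sequences `(σ⁽ᵏ⁾)_{k ≥ 1}` of density matrices. The entry with index `k : ℕ` is the density
matrix of order `k + 1`. -/
abbrev Hierarchy : Type := ∀ k : ℕ, DensityMatrix (k + 1)

/-- `‖Σ‖_{𝓗^α_ξ} = ∑_{k ≥ 1} ξᵏ ‖σ⁽ᵏ⁾‖_{H^α}`. -/
def hierarchyNorm (α ξ : ℝ) (S : Hierarchy) : ℝ≥0∞ :=
  ∑' k : ℕ, ENNReal.ofReal (ξ ^ (k + 1)) * sobolevNorm α (S k)

/-- The ordering `|ξ_1| > ⋯ > |ξ_m| > |ξ'_1| > ⋯ > |ξ'_m|`. -/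
def NonresonantOrder {m : ℕ} (ξ ξ' : Fin m → Freq) : Prop :=
  (StrictAnti fun j => freqNorm (ξ j)) ∧ (StrictAnti fun j => freqNorm (ξ' j)) ∧
    ∀ i j, freqNorm (ξ' j) < freqNorm (ξ i)

/-- The non-resonant class `𝓝` (at regularity `α`). -/
def Nonresonant (α : ℝ) (S : Hierarchy) : Prop :=
  (∀ (m : ℕ) (ξ ξ' : Fin (m + 1) → Freq),
    ¬ NonresonantOrder ξ ξ' → fourierCoef (S m) ξ ξ' = 0) ∧
  ∃ C : ℝ, 0 < C ∧ ∀ m : ℕ, sobolevNorm α (S m) ≤ ENNReal.ofReal (C ^ (m + 1))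

/-! ### Random density matrices -/

section Random

variable {Ω : Type*} [MeasurableSpace Ω]

/-- A family of independent random variables indexed by the frequencies, each of which takes the
values `1` and `-1` with probability `1/2`. -/
structure IsBernoulliFamily (P : Measure Ω) (h : Freq → Ω → ℝ) : Prop where
  measurable : ∀ ζ, Measurable (h ζ)
  indep : iIndepFun h P
  prob_one : ∀ ζ, P {ω | h ζ ω = 1} = 1 / 2
  prob_neg_one : ∀ ζ, P {ω | h ζ ω = -1} = 1 / 2

/-- Random density matrices of order `k`, i.e. elements of `L²(Ω; L²(Λᵏ × Λᵏ))`. -/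
abbrev RandomDensityMatrix (P : Measure Ω) (k : ℕ) : Type _ := Lp (DensityMatrix k) 2 P

/-- `‖σ‖_{L²(Ω) H^α(Λᵏ × Λᵏ)}`, the `L²(Ω)` norm of `ω ↦ ‖σ(ω)‖_{H^α}`. -/
def randomSobolevNorm {P : Measure Ω} {k : ℕ} (α : ℝ) (σ : RandomDensityMatrix P k) : ℝ≥0∞ :=
  (∫⁻ ω, sobolevNorm α (σ ω) ^ 2 ∂P) ^ (1 / 2 : ℝ)

/-- Sequences of random density matrices; the entry with index `k : ℕ` has order `k + 1`. -/
abbrev RandomHierarchy (P : Measure Ω) : Type _ := ∀ k : ℕ, RandomDensityMatrix P (k + 1)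

/-- `‖Σ‖_{L²(Ω) 𝓗^α_ξ} = ∑_{k ≥ 1} ξᵏ ‖σ⁽ᵏ⁾‖_{L²(Ω) H^α}`. -/
def randomHierarchyNorm {P : Measure Ω} (α ξ : ℝ) (S : RandomHierarchy P) : ℝ≥0∞ :=
  ∑' k : ℕ, ENNReal.ofReal (ξ ^ (k + 1)) * randomSobolevNorm α (S k)

/-- `Γ ∈ C_{t ∈ [0,T]} L²(Ω) 𝓗^α_ξ`: continuity of `t ↦ Γ(t)` on `[0,T]` as a map into the space
of sequences of finite `L²(Ω) 𝓗^α_ξ` norm. -/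
def ContinuousInTime {P : Measure Ω} (α ξ T : ℝ) (Γ : ℝ → RandomHierarchy P) : Prop :=
  ∀ t ∈ Set.Icc 0 T, randomHierarchyNorm α ξ (Γ t) < ∞ ∧
    Tendsto (fun s => randomHierarchyNorm α ξ (Γ s - Γ t)) (𝓝[Set.Icc 0 T] t) (𝓝 0)

/-! ### The randomized collision operator -/

/-- The summand with index `(ξ_{k+1}, ξ'_{k+1}) = p` of the series defining the Fourier coefficient
of `[B⁺_{j,k+1}]^ω σ` at `(ξ; ξ')`. -/
def collisionPlusTerm (h : Freq → Ω → ℝ) {k : ℕ} (j : Fin k) (σ : Ω → DensityMatrix (k + 1))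
    (ξ ξ' : Fin k → Freq) (p : Freq × Freq) (ω : Ω) : ℂ :=
  (h (ξ j) ω * h (ξ j - p.1 + p.2) ω * h p.1 ω * h p.2 ω : ℝ) *
    fourierCoef (σ ω) (Fin.snoc (α := fun _ => Freq) (Function.update ξ j (ξ j - p.1 + p.2)) p.1)
      (Fin.snoc (α := fun _ => Freq) ξ' p.2)

/-- The summand with index `(ξ_{k+1}, ξ'_{k+1}) = p` of the series defining the Fourier coefficient
of `[B⁻_{j,k+1}]^ω σ` at `(ξ; ξ')`. -/
def collisionMinusTerm (h : Freq → Ω → ℝ) {k : ℕ} (j : Fin k) (σ : Ω → DensityMatrix (k + 1))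
    (ξ ξ' : Fin k → Freq) (p : Freq × Freq) (ω : Ω) : ℂ :=
  (h (ξ' j) ω * h (ξ' j - p.2 + p.1) ω * h p.1 ω * h p.2 ω : ℝ) *
    fourierCoef (σ ω) (Fin.snoc (α := fun _ => Freq) ξ p.1)
      (Fin.snoc (α := fun _ => Freq) (Function.update ξ' j (ξ' j - p.2 + p.1)) p.2)

/-- `θ` has the Fourier coefficients `∑_p term ξ ξ' p`, where for each `(ξ; ξ')` the series of
random variables converges unconditionally in `L²(Ω)`. -/
def HasFourierSeries (P : Measure Ω) {k : ℕ}
    (term : (Fin k → Freq) → (Fin k → Freq) → Freq × Freq → Ω → ℂ)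
    (θ : RandomDensityMatrix P k) : Prop :=
  ∀ ξ ξ' : Fin k → Freq,
    Tendsto (fun F : Finset (Freq × Freq) =>
      eLpNorm (fun ω => fourierCoef (θ ω) ξ ξ' - ∑ p ∈ F, term ξ ξ' p ω) 2 P) atTop (𝓝 0)

theorem aestronglyMeasurable_fourierCoef {P : Measure Ω} {k : ℕ} (θ : RandomDensityMatrix P k)
    (ξ ξ' : Fin k → Freq) : AEStronglyMeasurable (fun ω => fourierCoef (θ ω) ξ ξ') P := by
  have hc : Continuous fun σ : DensityMatrix k => fourierCoef σ ξ ξ' := by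
    simp_rw [← characterBasis_repr, HilbertBasis.repr_apply_apply]
    fun_prop
  exact hc.comp_aestronglyMeasurable (Lp.aestronglyMeasurable θ)

/-- A random density matrix is determined by such a series. -/
theorem HasFourierSeries.unique {P : Measure Ω} {k : ℕ}
    {term : (Fin k → Freq) → (Fin k → Freq) → Freq × Freq → Ω → ℂ}
    (hm : ∀ ξ ξ' p, AEStronglyMeasurable (term ξ ξ' p) P) {θ θ' : RandomDensityMatrix P k}
    (hθ : HasFourierSeries P term θ) (hθ' : HasFourierSeries P term θ') : θ = θ' := by
  have key : ∀ q : (Fin k → Freq) × (Fin k → Freq),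
      ∀ᵐ ω ∂P, fourierCoef (θ ω) q.1 q.2 = fourierCoef (θ' ω) q.1 q.2 := by
    rintro ⟨ξ, ξ'⟩
    have hS : ∀ F : Finset (Freq × Freq), AEStronglyMeasurable (∑ p ∈ F, term ξ ξ' p) P :=
      fun F => Finset.aestronglyMeasurable_sum F fun p _ => hm ξ ξ' p
    have hle : ∀ F : Finset (Freq × Freq),
        eLpNorm (fun ω => fourierCoef (θ ω) ξ ξ' - fourierCoef (θ' ω) ξ ξ') 2 P ≤
          eLpNorm (fun ω => fourierCoef (θ ω) ξ ξ' - ∑ p ∈ F, term ξ ξ' p ω) 2 P +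
          eLpNorm (fun ω => fourierCoef (θ' ω) ξ ξ' - ∑ p ∈ F, term ξ ξ' p ω) 2 P := by
      intro F
      have h1 := (aestronglyMeasurable_fourierCoef θ ξ ξ').sub (hS F)
      have h2 := (aestronglyMeasurable_fourierCoef θ' ξ ξ').sub (hS F)
      have h3 := eLpNorm_sub_le h1 h2 (p := 2) (by norm_num)
      convert h3 using 2
      · ext ω
        simp
      · congr 1
        ext ω
        simp
      · congr 1
        ext ω
        simp
    have hz : eLpNorm (fun ω => fourierCoef (θ ω) ξ ξ' - fourierCoef (θ' ω) ξ ξ') 2 P = 0 := by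
      have hlim := (hθ ξ ξ').add (hθ' ξ ξ')
      rw [add_zero] at hlim
      exact le_antisymm (ge_of_tendsto' hlim hle) bot_le
    have hae := (eLpNorm_eq_zero_iff ((aestronglyMeasurable_fourierCoef θ ξ ξ').sub
      (aestronglyMeasurable_fourierCoef θ' ξ ξ')) (by norm_num : (2 : ℝ≥0∞) ≠ 0)).1 hz
    filter_upwards [hae] with ω hω
    exact sub_eq_zero.1 hω
  apply Lp.ext
  filter_upwards [ae_all_iff.2 key] with ω hω
  exact fourierCoef_ext fun ξ ξ' => hω (ξ, ξ')

/-- `[B⁺_{j,k+1}]^ω σ` exists as a random density matrix. -/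
def CollisionPlusDefined {P : Measure Ω} (h : Freq → Ω → ℝ) {k : ℕ} (j : Fin k)
    (σ : RandomDensityMatrix P (k + 1)) : Prop :=
  ∃ θ : RandomDensityMatrix P k, HasFourierSeries P (collisionPlusTerm h j σ) θ

/-- `[B⁻_{j,k+1}]^ω σ` exists as a random density matrix. -/
def CollisionMinusDefined {P : Measure Ω} (h : Freq → Ω → ℝ) {k : ℕ} (j : Fin k)
    (σ : RandomDensityMatrix P (k + 1)) : Prop :=
  ∃ θ : RandomDensityMatrix P k, HasFourierSeries P (collisionMinusTerm h j σ) θ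

open Classical in
/-- `[B⁺_{j,k+1}]^ω σ`; the value is `0` outside the domain `CollisionPlusDefined`. -/
def collisionPlus {P : Measure Ω} (h : Freq → Ω → ℝ) {k : ℕ} (j : Fin k)
    (σ : RandomDensityMatrix P (k + 1)) : RandomDensityMatrix P k :=
  if hσ : CollisionPlusDefined h j σ then hσ.choose else 0

open Classical in
/-- `[B⁻_{j,k+1}]^ω σ`; the value is `0` outside the domain `CollisionMinusDefined`. -/
def collisionMinus {P : Measure Ω} (h : Freq → Ω → ℝ) {k : ℕ} (j : Fin k)
    (σ : RandomDensityMatrix P (k + 1)) : RandomDensityMatrix P k :=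
  if hσ : CollisionMinusDefined h j σ then hσ.choose else 0

/-- `σ` is in the domain of the full randomized collision operator `[B^{(k+1)}]^ω`. -/
def CollisionDefined {P : Measure Ω} (h : Freq → Ω → ℝ) {k : ℕ}
    (σ : RandomDensityMatrix P (k + 1)) : Prop :=
  ∀ j : Fin k, CollisionPlusDefined h j σ ∧ CollisionMinusDefined h j σ

/-- The full randomized collision operator
`[B^{(k+1)}]^ω σ = ∑_{j=1}^k ([B⁺_{j,k+1}]^ω σ - [B⁻_{j,k+1}]^ω σ)`. -/
def collision {P : Measure Ω} (h : Freq → Ω → ℝ) {k : ℕ} (σ : RandomDensityMatrix P (k + 1)) :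
    RandomDensityMatrix P k :=
  ∑ j : Fin k, (collisionPlus h j σ - collisionMinus h j σ)

/-! ### The Duhamel identity -/

/-- The component of order `k + 1` of the integrand `s ↦ U(t-s) [B̂]^ω Γ(s)`. -/
def duhamelIntegrand {P : Measure Ω} (h : Freq → Ω → ℝ) (Γ : ℝ → RandomHierarchy P) (t : ℝ)
    (k : ℕ) (s : ℝ) : RandomDensityMatrix P (k + 1) :=
  (freeEvolution (k + 1) (t - s)).compLp (collision h (Γ s (k + 1)))

/-- `Γ(t) - U(t) Γ(0) + i ∫_0^t U(t-s) [B̂]^ω Γ(s) ds`, for deterministic initial data `Γ(0) = Γ₀`;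
the integral is a Bochner integral in `L²(Ω; L²)` in each component. -/
def duhamelDefect {P : Measure Ω} [IsProbabilityMeasure P] (h : Freq → Ω → ℝ) (Γ₀ : Hierarchy)
    (Γ : ℝ → RandomHierarchy P) (t : ℝ) : RandomHierarchy P := fun k =>
  Γ t k - Lp.const 2 P (freeEvolution (k + 1) t (Γ₀ k)) +
    Complex.I • ∫ s in (0 : ℝ)..t, duhamelIntegrand h Γ t k s

end Random

end GP

end

noncomputable section

namespace GP

/-! The solution is the full Duhamel series, summed over all collision histories. What makes it
converge is that iterated randomized collisions of non-resonant data lose nothing in `L²(Ω; L²)`.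

Let `D(X)` be the product of the random signs of all frequencies of a configuration `X`. The
collision `B^±_j` moves the coefficient at `Y` to the contracted configuration `X` and multiplies it
by four signs, whose product is almost surely `D(X) D(Y)` (`collisionSign_mul_signProd`). Along a
history the intermediate signs square to one. A history with total contraction `R` therefore sends
coefficients `f(F)` to `∑_F f(F) D(F) D(R F) e_{R F}`, which is `synth R f`; one more collision
replaces `R` by its composition with `contract` (`hasSum_collisionTermL_synth`).

In a non-resonant `F` all frequencies have distinct moduli and are sorted by them, so `D(F)` is a
product of distinct independent signs, and the set of these frequencies determines `F`
(`freqs_injOn`). Different `F` thus give orthogonal `D(F)`, and `synth R` is an isometry for every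
map `R`, however many `F` share the same image (`orthonormal_embedMode_signVec`). Only the initial
configurations need be non-resonant, so the argument survives any number of collisions.

It remains to count. A collision costs `2^α` in the Sobolev weight (`weight_contract_le`). There are
`2^ℓ (k+1)⋯(k+ℓ)` histories of length `ℓ` ending at order `k`, and the time simplex contributes
`T^ℓ/ℓ!`, so that binomial coefficients are left (`card_history_le`). The powers of `ξ'` in the data
norm then give geometric series in `ℓ` and in `k` (`tsum_tsum_majorant_le`). Absolute convergence
justifies termwise collision and integration (`hasSum_collisionTermL`,
`hasSum_integral_collidedTerm`), and splitting off the latest collision shows that the series solves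
the Duhamel equation (`duhamelSeries_eq`). -/

/-- Pairs `(ξ; ξ')` of frequency vectors of order `k`. -/
abbrev Config (k : ℕ) : Type := (Fin k → Freq) × (Fin k → Freq)

/-- Non-resonantly ordered configurations. -/
abbrev NRConfig (n : ℕ) : Type := {F : Config n // NonresonantOrder F.1 F.2}

/-! ### Collisions as maps between configurations -/

/-- The frequencies at which `σ̂` is evaluated in the term with index `p` of the series for
`B⁺_{j,k+1} σ` (if `s`) or `B⁻_{j,k+1} σ` (if not `s`) at `X`. -/
def expand (s : Bool) {k : ℕ} (j : Fin k) (X : Config k) (p : Freq × Freq) : Config (k + 1) :=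
  match s with
  | true => (Fin.snoc (α := fun _ => Freq) (Function.update X.1 j (X.1 j - p.1 + p.2)) p.1,
      Fin.snoc (α := fun _ => Freq) X.2 p.2)
  | false => (Fin.snoc (α := fun _ => Freq) X.1 p.1,
      Fin.snoc (α := fun _ => Freq) (Function.update X.2 j (X.2 j - p.2 + p.1)) p.2)

/-- The last pair of frequencies of a configuration. -/
def lastPair {k : ℕ} (Y : Config (k + 1)) : Freq × Freq := (Y.1 (Fin.last k), Y.2 (Fin.last k))

/-- The configuration of order `k` to which the value of `σ̂` at `Y` contributes under
`B^±_{j,k+1}`. -/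
def contract (s : Bool) {k : ℕ} (j : Fin k) (Y : Config (k + 1)) : Config k :=
  match s with
  | true => (Function.update (Fin.init Y.1) j
      (Y.1 j.castSucc + Y.1 (Fin.last k) - Y.2 (Fin.last k)), Fin.init Y.2)
  | false => (Fin.init Y.1, Function.update (Fin.init Y.2) j
      (Y.2 j.castSucc + Y.2 (Fin.last k) - Y.1 (Fin.last k)))

theorem contract_expand (s : Bool) {k : ℕ} (j : Fin k) (X : Config k) (p : Freq × Freq) :
    contract s j (expand s j X p) = X := by
  have h : ∀ u a b : Freq, u - a + b + a - b = u := fun u a b => by abel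
  cases s <;> simp [contract, expand, h, -Fin.snoc_update]

theorem lastPair_expand (s : Bool) {k : ℕ} (j : Fin k) (X : Config k) (p : Freq × Freq) :
    lastPair (expand s j X p) = p := by
  cases s <;> simp [lastPair, expand, -Fin.snoc_update]

theorem expand_contract (s : Bool) {k : ℕ} (j : Fin k) (Y : Config (k + 1)) :
    expand s j (contract s j Y) (lastPair Y) = Y := by
  have h : ∀ u a b : Freq, u + a - b - a + b = u := fun u a b => by abel
  cases s
  · ext1
    · simp [expand, contract, lastPair]
    · simp [expand, contract, lastPair, h]
  · ext1
    · simp [expand, contract, lastPair, h]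
    · simp [expand, contract, lastPair]

/-- For fixed `s` and `j`, `contract` and `lastPair` together invert `expand`. Summing over `p` in
the collision series at `X` is therefore summing over the fibre of `contract` above `X`. -/
theorem expand_eq_iff {s : Bool} {k : ℕ} {j : Fin k} {X : Config k} {p : Freq × Freq}
    {Y : Config (k + 1)} : Y = expand s j X p ↔ contract s j Y = X ∧ lastPair Y = p := by
  constructor
  · rintro rfl
    exact ⟨contract_expand s j X p, lastPair_expand s j X p⟩
  · rintro ⟨rfl, rfl⟩
    exact (expand_contract s j Y).symm

/-! ### Weights -/

theorem freqSq_nonneg (ζ : Freq) : 0 ≤ freqSq ζ := Finset.sum_nonneg fun _ _ => sq_nonneg _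

theorem one_le_bracket (ζ : Freq) : 1 ≤ bracket ζ :=
  Real.one_le_sqrt.2 (by linarith [freqSq_nonneg ζ])

theorem bracket_pos (ζ : Freq) : 0 < bracket ζ := zero_lt_one.trans_le (one_le_bracket ζ)

theorem freqSq_add_le (x y : Freq) : freqSq (x + y) ≤ 2 * freqSq x + 2 * freqSq y := by
  simp only [freqSq, Finset.mul_sum, ← Finset.sum_add_distrib]
  refine Finset.sum_le_sum fun c _ => ?_
  push_cast [Pi.add_apply]
  nlinarith [sq_nonneg ((x c : ℝ) - y c)]

theorem freqSq_neg (x : Freq) : freqSq (-x) = freqSq x := by simp [freqSq]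

theorem bracket_neg (x : Freq) : bracket (-x) = bracket x := by simp [bracket, freqSq_neg]

theorem bracket_add_le (x y : Freq) : bracket (x + y) ≤ √2 * (bracket x * bracket y) := by
  have hx := freqSq_nonneg x
  have hy := freqSq_nonneg y
  rw [bracket, bracket, bracket, ← Real.sqrt_mul (by positivity), ← Real.sqrt_mul (by positivity)]
  refine Real.sqrt_le_sqrt ?_
  nlinarith [freqSq_add_le x y, mul_nonneg hx hy]

/-- Two applications of the Peetre-type bound, each with a factor `√2`. -/
theorem bracket_add_sub_le (x a b : Freq) :
    bracket (x + a - b) ≤ 2 * (bracket x * bracket a * bracket b) := by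
  have h1 := bracket_add_le (x + a) (-b)
  have h2 := bracket_add_le x a
  rw [bracket_neg, ← sub_eq_add_neg] at h1
  have hb := bracket_pos b
  calc bracket (x + a - b) ≤ √2 * (bracket (x + a) * bracket b) := h1
    _ ≤ √2 * ((√2 * (bracket x * bracket a)) * bracket b) := by gcongr
    _ = (√2 * √2) * (bracket x * bracket a * bracket b) := by ring
    _ = _ := by rw [Real.mul_self_sqrt (by norm_num)]

theorem bracket_rpow_add_sub_le {α : ℝ} (hα : 0 ≤ α) (x a b : Freq) :
    bracket (x + a - b) ^ α ≤ 2 ^ α * (bracket x ^ α * bracket a ^ α * bracket b ^ α) := by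
  have hx := bracket_pos x
  have ha := bracket_pos a
  have hb := bracket_pos b
  rw [← Real.mul_rpow hx.le ha.le, ← Real.mul_rpow (by positivity) hb.le,
    ← Real.mul_rpow (by norm_num) (by positivity)]
  exact Real.rpow_le_rpow (bracket_pos _).le (bracket_add_sub_le x a b) hα

/-- The weight of a configuration. -/
abbrev weight {k : ℕ} (α : ℝ) (X : Config k) : ℝ := sobolevWeight α X.1 X.2

theorem one_le_sobolevWeight {α : ℝ} (hα : 0 ≤ α) {k : ℕ} (ξ ξ' : Fin k → Freq) :
    1 ≤ sobolevWeight α ξ ξ' := by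
  have h : ∀ v : Fin k → Freq, 1 ≤ ∏ j, bracket (v j) ^ α := fun v =>
    Finset.one_le_prod fun j _ => Real.one_le_rpow (one_le_bracket _) hα
  exact one_le_mul_of_one_le_of_one_le (h ξ) (h ξ')

theorem sobolevWeight_mono {α β : ℝ} (h : α ≤ β) {k : ℕ} (ξ ξ' : Fin k → Freq) :
    sobolevWeight α ξ ξ' ≤ sobolevWeight β ξ ξ' := by
  have h0 : ∀ (γ : ℝ) (v : Fin k → Freq), 0 ≤ ∏ j, bracket (v j) ^ γ := fun γ v =>
    Finset.prod_nonneg fun j _ => Real.rpow_nonneg (bracket_pos _).le _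
  have h1 : ∀ v : Fin k → Freq, ∏ j, bracket (v j) ^ α ≤ ∏ j, bracket (v j) ^ β := fun v =>
    Finset.prod_le_prod (fun j _ => Real.rpow_nonneg (bracket_pos _).le _) fun j _ =>
      Real.rpow_le_rpow_of_exponent_le (one_le_bracket _) h
  exact mul_le_mul (h1 ξ) (h1 ξ') (h0 _ _) (h0 _ _)

/-- The brackets of the two deleted frequencies pay for the new one in slot `j`; all other factors
are unchanged. -/
theorem weight_contract_le {α : ℝ} (hα : 0 ≤ α) (s : Bool) {k : ℕ} (j : Fin k)
    (Y : Config (k + 1)) : weight α (contract s j Y) ≤ 2 ^ α * weight α Y := by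
  -- `v` is the half of the configuration that contains slot `j`, and `b` is the last frequency of
  -- the other half. This serves both signs.
  have key : ∀ (v : Fin (k + 1) → Freq) (b : Freq),
      (∏ i, bracket (Function.update (Fin.init v : Fin k → Freq) j
        (v j.castSucc + v (Fin.last k) - b) i) ^ α) ≤
        2 ^ α * ((∏ i, bracket (v i) ^ α) * bracket b ^ α) := by
    intro v b
    have hb : 0 ≤ bracket b ^ α := Real.rpow_nonneg (bracket_pos _).le _
    have hP : 0 ≤ ∏ i ∈ Finset.univ.erase j, bracket (v i.castSucc) ^ α :=
      Finset.prod_nonneg fun i _ => Real.rpow_nonneg (bracket_pos _).le _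
    rw [Fin.prod_univ_castSucc, ← Finset.mul_prod_erase _ _ (Finset.mem_univ j),
      ← Finset.mul_prod_erase _ (fun i : Fin k => bracket (v i.castSucc) ^ α)
        (Finset.mem_univ j), Function.update_self]
    have : ∏ i ∈ Finset.univ.erase j, bracket (Function.update (Fin.init v : Fin k → Freq) j
        (v j.castSucc + v (Fin.last k) - b) i) ^ α =
        ∏ i ∈ Finset.univ.erase j, bracket (v i.castSucc) ^ α := by
      refine Finset.prod_congr rfl fun i hi => ?_
      rw [Function.update_of_ne (Finset.ne_of_mem_erase hi)]
      rfl
    rw [this]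
    calc _ ≤ 2 ^ α * (bracket (v j.castSucc) ^ α * bracket (v (Fin.last k)) ^ α *
          bracket b ^ α) * ∏ i ∈ Finset.univ.erase j, bracket (v i.castSucc) ^ α :=
          mul_le_mul_of_nonneg_right (bracket_rpow_add_sub_le hα _ _ _) hP
      _ = _ := by ring
  have h0 : ∀ {m : ℕ} (v : Fin m → Freq), 0 ≤ ∏ i, bracket (v i) ^ α := fun v =>
    Finset.prod_nonneg fun i _ => Real.rpow_nonneg (bracket_pos _).le _
  have hi : ∀ v : Fin (k + 1) → Freq, (∏ i, bracket ((Fin.init v : Fin k → Freq) i) ^ α) *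
      bracket (v (Fin.last k)) ^ α = ∏ i, bracket (v i) ^ α := by
    intro v
    rw [Fin.prod_univ_castSucc]
    rfl
  cases s
  · have := mul_le_mul_of_nonneg_left (key Y.2 (Y.1 (Fin.last k))) (h0 (Fin.init Y.1))
    refine this.trans (le_of_eq ?_)
    simp only [weight, sobolevWeight]
    rw [← hi Y.1]
    ring
  · have := mul_le_mul_of_nonneg_right (key Y.1 (Y.2 (Fin.last k))) (h0 (Fin.init Y.2))
    refine this.trans (le_of_eq ?_)
    simp only [weight, sobolevWeight]
    rw [← hi Y.2]
    ring

/-! ### Non-resonant configurations -/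

/-- The set of frequencies of a configuration. -/
def freqs {n : ℕ} (F : Config n) : Finset Freq :=
  Finset.univ.image (Sum.elim F.1 F.2)

/-- The lexicographic sum puts the unprimed frequencies before the primed ones, so the three
conditions become one strictly decreasing sequence of moduli. -/
theorem NonresonantOrder.strictAnti {n : ℕ} {F : Config n} (hF : NonresonantOrder F.1 F.2) :
    StrictAnti fun i : Fin n ⊕ₗ Fin n => freqNorm (Sum.elim F.1 F.2 (ofLex i)) := by
  intro a b hab
  rcases a with a | a <;> rcases b with b | b
  · exact hF.1 (Sum.Lex.inl_lt_inl_iff.1 hab)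
  · exact hF.2.2 a b
  · exact absurd hab Sum.Lex.not_inr_lt_inl
  · exact hF.2.1 (Sum.Lex.inr_lt_inr_iff.1 hab)

theorem NonresonantOrder.injective {n : ℕ} {F : Config n} (hF : NonresonantOrder F.1 F.2) :
    Function.Injective (Sum.elim F.1 F.2) := fun a b hab =>
  toLex.injective (hF.strictAnti.injective (by simp [hab]))

/-- A finite set with distinct moduli can be listed in decreasing order in only one way. -/
theorem freqs_injOn {n : ℕ} {F G : Config n} (hF : NonresonantOrder F.1 F.2)
    (hG : NonresonantOrder G.1 G.2) (h : freqs F = freqs G) : F = G := by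
  have hr : Set.range (Sum.elim F.1 F.2) = Set.range (Sum.elim G.1 G.2) := by
    simpa [freqs, ← Finset.coe_inj] using h
  have hn : (fun i : Fin n ⊕ₗ Fin n => freqNorm (Sum.elim F.1 F.2 (ofLex i))) =
      fun i => freqNorm (Sum.elim G.1 G.2 (ofLex i)) := by
    have hF' : StrictMono fun i : Fin n ⊕ₗ Fin n =>
      OrderDual.toDual (freqNorm (Sum.elim F.1 F.2 (ofLex i))) := hF.strictAnti
    have hG' : StrictMono fun i : Fin n ⊕ₗ Fin n =>
      OrderDual.toDual (freqNorm (Sum.elim G.1 G.2 (ofLex i))) := hG.strictAnti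
    refine (StrictMono.range_inj hF' hG').1 ?_
    have e : ∀ f : Fin n ⊕ Fin n → Freq,
        (Set.range fun i : Fin n ⊕ₗ Fin n => OrderDual.toDual (freqNorm (f (ofLex i)))) =
          (fun ζ => OrderDual.toDual (freqNorm ζ)) '' Set.range f := by
      intro f
      ext x
      constructor
      · rintro ⟨i, rfl⟩
        exact ⟨_, ⟨ofLex i, rfl⟩, rfl⟩
      · rintro ⟨_, ⟨i, rfl⟩, rfl⟩
        exact ⟨toLex i, rfl⟩
    rw [e, e, hr]
  -- The sequences of moduli agree. Each frequency of `F` occurs somewhere in `G`, and its modulus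
  -- fixes the position.
  have hfun : Sum.elim F.1 F.2 = Sum.elim G.1 G.2 := by
    funext i
    obtain ⟨j, hj⟩ : Sum.elim F.1 F.2 i ∈ Set.range (Sum.elim G.1 G.2) := hr ▸ ⟨i, rfl⟩
    have h1 := congrFun hn (toLex i)
    simp only [ofLex_toLex, ← hj] at h1
    have : toLex j = toLex i := hG.strictAnti.injective (by simpa using h1)
    rw [← hj, toLex.injective this]
  ext1
  · funext i
    exact congrFun hfun (Sum.inl i)
  · funext i
    exact congrFun hfun (Sum.inr i)

/-! ### Random signs and their orthogonality -/

section Probability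

variable {Ω : Type*} {h : Freq → Ω → ℝ}

/-- The product of the random signs of the frequencies of a configuration. -/
def signProd (h : Freq → Ω → ℝ) {k : ℕ} (X : Config k) (ω : Ω) : ℝ :=
  (∏ j, h (X.1 j) ω) * ∏ j, h (X.2 j) ω

/-- The product of the four random signs in the summands of the collision operators. -/
def collisionSign (h : Freq → Ω → ℝ) (s : Bool) {k : ℕ} (j : Fin k) (X : Config k)
    (p : Freq × Freq) (ω : Ω) : ℝ :=
  match s with
  | true => h (X.1 j) ω * h (X.1 j - p.1 + p.2) ω * h p.1 ω * h p.2 ω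
  | false => h (X.2 j) ω * h (X.2 j - p.2 + p.1) ω * h p.1 ω * h p.2 ω

/-- The signs of the two last frequencies and of the modified slot `j` appear twice and cancel; the
remaining sign restores that of the original slot. -/
theorem collisionSign_mul_signProd {ω : Ω} (hω : ∀ ζ, h ζ ω * h ζ ω = 1) (s : Bool) {k : ℕ}
    (j : Fin k) (X : Config k) (p : Freq × Freq) :
    collisionSign h s j X p ω * signProd h (expand s j X p) ω = signProd h X ω := by
  have key : ∀ (v : Fin k → Freq) (x : Freq),
      h (v j) ω * h x ω * ∏ i, h (Function.update v j x i) ω = ∏ i, h (v i) ω := by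
    intro v x
    rw [← Finset.mul_prod_erase _ _ (Finset.mem_univ j),
      ← Finset.mul_prod_erase _ (fun i : Fin k => h (v i) ω) (Finset.mem_univ j),
      Function.update_self]
    have : ∏ i ∈ Finset.univ.erase j, h (Function.update v j x i) ω =
        ∏ i ∈ Finset.univ.erase j, h (v i) ω :=
      Finset.prod_congr rfl fun i hi => by
        rw [Function.update_of_ne (Finset.ne_of_mem_erase hi)]
    rw [this]
    linear_combination (h (v j) ω * ∏ i ∈ Finset.univ.erase j, h (v i) ω) * hω x
  cases s
  · simp only [collisionSign, signProd, expand, Fin.prod_univ_castSucc, Fin.snoc_castSucc,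
      Fin.snoc_last]
    linear_combination (h p.1 ω * h p.1 ω * (h p.2 ω * h p.2 ω) * ∏ i, h (X.1 i) ω) *
      key X.2 (X.2 j - p.2 + p.1) +
      ((∏ i, h (X.1 i) ω) * ∏ i, h (X.2 i) ω) * (h p.1 ω * h p.1 ω * hω p.2 + hω p.1)
  · simp only [collisionSign, signProd, expand, Fin.prod_univ_castSucc, Fin.snoc_castSucc,
      Fin.snoc_last]
    linear_combination (h p.1 ω * h p.1 ω * (h p.2 ω * h p.2 ω) * ∏ i, h (X.2 i) ω) *
      key X.1 (X.1 j - p.1 + p.2) +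
      ((∏ i, h (X.1 i) ω) * ∏ i, h (X.2 i) ω) * (h p.1 ω * h p.1 ω * hω p.2 + hω p.1)

theorem signProd_mul_self {ω : Ω} (hω : ∀ ζ, h ζ ω * h ζ ω = 1) {k : ℕ} (X : Config k) :
    signProd h X ω * signProd h X ω = 1 := by
  have hp : ∀ v : Fin k → Freq, (∏ i, h (v i) ω) * ∏ i, h (v i) ω = 1 := fun v => by
    rw [← Finset.prod_mul_distrib]
    exact Finset.prod_eq_one fun i _ => hω _
  rw [signProd]
  linear_combination (∏ i, h (X.1 i) ω) * (∏ i, h (X.1 i) ω) * hp X.2 + hp X.1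

theorem collisionSign_mul_self {ω : Ω} (hω : ∀ ζ, h ζ ω * h ζ ω = 1) (s : Bool) {k : ℕ}
    (j : Fin k) (X : Config k) (p : Freq × Freq) :
    collisionSign h s j X p ω * collisionSign h s j X p ω = 1 := by
  have h1 := collisionSign_mul_signProd hω s j X p
  have h2 := signProd_mul_self hω (expand s j X p)
  have h3 := signProd_mul_self hω X
  rw [← h1] at h3
  linear_combination h3 - collisionSign h s j X p ω ^ 2 * h2

/-- Non-resonance excludes repetitions, so no sign is squared away. -/
theorem signProd_eq_prod_freqs {n : ℕ} {F : Config n} (hF : NonresonantOrder F.1 F.2) (ω : Ω) :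
    signProd h F ω = ∏ ζ ∈ freqs F, h ζ ω := by
  rw [freqs, Finset.prod_image fun a _ b _ hab => hF.injective hab, Fintype.prod_sum_type]
  rfl

variable [MeasurableSpace Ω] {P : Measure Ω}

namespace IsBernoulliFamily

theorem ae_mul_self [IsProbabilityMeasure P] (hh : IsBernoulliFamily P h) :
    ∀ᵐ ω ∂P, ∀ ζ, h ζ ω * h ζ ω = 1 := by
  rw [ae_all_iff]
  intro ζ
  have hm := hh.measurable ζ
  have hd : Disjoint {ω | h ζ ω = 1} {ω | h ζ ω = -1} :=
    Set.disjoint_left.2 fun ω (h1 : h ζ ω = 1) (h2 : h ζ ω = -1) => by linarith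
  have hu : P ({ω | h ζ ω = 1} ∪ {ω | h ζ ω = -1}) = 1 := by
    rw [measure_union hd (hm (measurableSet_singleton _)), hh.prob_one, hh.prob_neg_one]
    exact ENNReal.add_halves 1
  have hu' : ∀ᵐ ω ∂P, ω ∈ {ω | h ζ ω = 1} ∪ {ω | h ζ ω = -1} :=
    (mem_ae_iff_prob_eq_one ((hm (measurableSet_singleton 1)).union
      (hm (measurableSet_singleton (-1))))).2 hu
  filter_upwards [hu'] with ω hω
  rcases hω with hω | hω
  · rw [show h ζ ω = 1 from hω, one_mul]
  · rw [show h ζ ω = -1 from hω]; norm_num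

theorem integral_eq_zero [IsProbabilityMeasure P] (hh : IsBernoulliFamily P h) (ζ : Freq) :
    ∫ ω, h ζ ω ∂P = 0 := by
  have hm := hh.measurable ζ
  have m1 : MeasurableSet {ω | h ζ ω = 1} := hm (measurableSet_singleton _)
  have m2 : MeasurableSet {ω | h ζ ω = -1} := hm (measurableSet_singleton _)
  have hae : (fun ω => h ζ ω) =ᵐ[P] fun ω =>
      {ω | h ζ ω = 1}.indicator (fun _ => (1 : ℝ)) ω -
        {ω | h ζ ω = -1}.indicator (fun _ => (1 : ℝ)) ω := by
    filter_upwards [hh.ae_mul_self] with ω hω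
    rcases mul_self_eq_one_iff.1 (hω ζ) with h1 | h1 <;> norm_num [Set.indicator, h1]
  rw [integral_congr_ae hae, integral_sub ((integrable_const _).indicator m1)
    ((integrable_const _).indicator m2), integral_indicator_const _ m1,
    integral_indicator_const _ m2]
  simp [Measure.real, hh.prob_one, hh.prob_neg_one]

/-- Any one sign is independent of the product of the others and has mean zero. -/
theorem integral_prod_eq_zero [IsProbabilityMeasure P] (hh : IsBernoulliFamily P h)
    {A : Finset Freq} (hA : A.Nonempty) : ∫ ω, ∏ ζ ∈ A, h ζ ω ∂P = 0 := by
  obtain ⟨ζ, hζ⟩ := hA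
  have hi : IndepFun (∏ x ∈ A.erase ζ, h x) (h ζ) P :=
    hh.indep.indepFun_finsetProd_of_notMem (fun x => hh.measurable x) (Finset.notMem_erase ζ A)
  have := hi.integral_mul_eq_mul_integral
    (Finset.aestronglyMeasurable_prod _ fun x _ => (hh.measurable x).aestronglyMeasurable)
    (hh.measurable ζ).aestronglyMeasurable
  rw [hh.integral_eq_zero, mul_zero] at this
  rw [← this]
  refine integral_congr_ae (.of_forall fun ω => ?_)
  simp only [Pi.mul_apply, Finset.prod_apply]
  rw [Finset.prod_erase_mul _ _ hζ]

/-- Common frequencies contribute squares, equal to one. What is left is a product of signs over the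
symmetric difference of the two frequency sets, which is nonempty because the sets determine the
configurations. -/
theorem integral_signProd_mul_signProd [IsProbabilityMeasure P] (hh : IsBernoulliFamily P h)
    {n : ℕ} {F G : Config n} (hF : NonresonantOrder F.1 F.2) (hG : NonresonantOrder G.1 G.2)
    (hFG : F ≠ G) : ∫ ω, signProd h F ω * signProd h G ω ∂P = 0 := by
  have hne : (symmDiff (freqs F) (freqs G)).Nonempty := by
    rw [Finset.nonempty_iff_ne_empty]
    intro h0
    exact hFG (freqs_injOn hF hG (symmDiff_eq_bot.1 h0))
  rw [← hh.integral_prod_eq_zero hne]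
  refine integral_congr_ae ?_
  filter_upwards [hh.ae_mul_self] with ω hω
  rw [signProd_eq_prod_freqs hF, signProd_eq_prod_freqs hG, symmDiff_def, Finset.sup_eq_union,
    Finset.prod_union disjoint_sdiff_sdiff, ← Finset.prod_inter_mul_prod_sdiff (freqs F) (freqs G),
    ← Finset.prod_inter_mul_prod_sdiff (freqs G) (freqs F), Finset.inter_comm (freqs G) (freqs F)]
  have : (∏ ζ ∈ freqs F ∩ freqs G, h ζ ω) * ∏ ζ ∈ freqs F ∩ freqs G, h ζ ω = 1 := by
    rw [← Finset.prod_mul_distrib]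
    exact Finset.prod_eq_one fun i _ => hω _
  linear_combination ((∏ ζ ∈ freqs F \ freqs G, h ζ ω) * ∏ ζ ∈ freqs G \ freqs F, h ζ ω) * this

theorem measurable_signProd (hh : IsBernoulliFamily P h) {k : ℕ} (X : Config k) :
    Measurable (signProd h X) :=
  (Finset.measurable_prod _ fun _ _ => hh.measurable _).mul
    (Finset.measurable_prod _ fun _ _ => hh.measurable _)

theorem measurable_collisionSign (hh : IsBernoulliFamily P h) (s : Bool) {k : ℕ} (j : Fin k)
    (X : Config k) (p : Freq × Freq) : Measurable (collisionSign h s j X p) := by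
  cases s <;>
    exact (((hh.measurable _).mul (hh.measurable _)).mul (hh.measurable _)).mul (hh.measurable _)

end IsBernoulliFamily

end Probability

/-! ### Diagonal operators on `ℓ²` -/

section Diagonal

variable {ι : Type*}

theorem norm_mul_le_of_norm_le_one {φ z : ℂ} (hφ : ‖φ‖ ≤ 1) : ‖φ * z‖ ≤ ‖z‖ := by
  rw [norm_mul]
  exact mul_le_of_le_one_left (norm_nonneg z) hφ

/-- Multiplication by a function that is bounded by one, as a linear operator on `ℓ²`. -/
def diagMulₗ (φ : ι → ℂ) (hφ : ∀ i, ‖φ i‖ ≤ 1) :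
    lp (fun _ : ι => ℂ) 2 →ₗ[ℂ] lp (fun _ : ι => ℂ) 2 where
  toFun f := ⟨fun i => φ i * f i,
    (lp.memℓp f).mono' fun i => norm_mul_le_of_norm_le_one (hφ i)⟩
  map_add' f g := by
    ext i
    exact mul_add _ _ _
  map_smul' c f := by
    ext i
    exact mul_left_comm _ _ _

/-- Multiplication by a function that is bounded by one, as an operator on `ℓ²`. -/
def diagMul (φ : ι → ℂ) (hφ : ∀ i, ‖φ i‖ ≤ 1) :
    lp (fun _ : ι => ℂ) 2 →L[ℂ] lp (fun _ : ι => ℂ) 2 :=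
  (diagMulₗ φ hφ).mkContinuous 1 fun f => by
    rw [one_mul]
    exact lp.norm_mono two_ne_zero fun i => norm_mul_le_of_norm_le_one (hφ i)

@[simp]
theorem diagMul_apply (φ : ι → ℂ) (hφ : ∀ i, ‖φ i‖ ≤ 1) (f : lp (fun _ : ι => ℂ) 2) (i : ι) :
    diagMul φ hφ f i = φ i * f i := rfl

theorem norm_diagMul_le (φ : ι → ℂ) (hφ : ∀ i, ‖φ i‖ ≤ 1) (f : lp (fun _ : ι => ℂ) 2) :
    ‖diagMul φ hφ f‖ ≤ ‖f‖ :=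
  lp.norm_mono two_ne_zero fun i => norm_mul_le_of_norm_le_one (hφ i)

/-- Restriction of an element of `ℓ²` to a set. -/
def restrictTo (S : Set ι) : lp (fun _ : ι => ℂ) 2 →L[ℂ] lp (fun _ : ι => ℂ) 2 :=
  diagMul (S.indicator 1) fun i => by
    by_cases hi : i ∈ S <;> simp [hi]

theorem restrictTo_apply (S : Set ι) (f : lp (fun _ : ι => ℂ) 2) (i : ι) :
    restrictTo S f i = S.indicator (fun i => f i) i := by
  by_cases hi : i ∈ S <;> simp [restrictTo, hi]

theorem norm_restrictTo_le (S : Set ι) (f : lp (fun _ : ι => ℂ) 2) : ‖restrictTo S f‖ ≤ ‖f‖ :=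
  norm_diagMul_le _ _ f

theorem sum_restrictTo_fiber {κ : Type*} (π : ι → κ) (S : Set ι) (s : Finset κ)
    (f : lp (fun _ : ι => ℂ) 2) :
    ∑ p ∈ s, restrictTo {i | i ∈ S ∧ π i = p} f = restrictTo {i | i ∈ S ∧ π i ∈ s} f := by
  classical
  ext i
  rw [lp.coeFn_sum, Finset.sum_apply]
  simp only [restrictTo_apply, Set.indicator_apply, Set.mem_ofPred_eq]
  by_cases hi : i ∈ S <;> simp [hi]

/-- Regrouping the unconditional expansion in coordinate vectors along the fibres of `π`. This is
the source of the unconditional convergence of the collision series. -/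
theorem hasSum_restrictTo_fiber {κ : Type*} (π : ι → κ) (S : Set ι) (f : lp (fun _ : ι => ℂ) 2) :
    HasSum (fun p => restrictTo {i | i ∈ S ∧ π i = p} f) (restrictTo S f) := by
  classical
  have h2 : (2 : ℝ≥0∞) ≠ ∞ := by norm_num
  have : Fact ((1 : ℝ≥0∞) ≤ 2) := ⟨by norm_num⟩
  have hs := (Equiv.sigmaFiberEquiv π).hasSum_iff.2 (lp.hasSum_single h2 (restrictTo S f))
  refine hs.sigma fun p => ?_
  have hp := lp.hasSum_single h2 (restrictTo {i | i ∈ S ∧ π i = p} f)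
  rw [← hasSum_subtype_iff_of_support_subset (s := {i | π i = p})] at hp
  · refine (congrArg (HasSum · _) (funext fun i => ?_)).mp hp
    have hi : π i = p := i.2
    have he : Equiv.sigmaFiberEquiv π ⟨p, i⟩ = i := rfl
    simp [restrictTo_apply, Set.indicator_apply, hi, he]
  · intro i hi
    by_contra hne
    refine hi ?_
    have : restrictTo {i | i ∈ S ∧ π i = p} f i = 0 := by
      rw [restrictTo_apply]
      exact Set.indicator_of_notMem (fun h => hne h.2) _
    simp only [this]
    exact lp.single_zero ..

end Diagonal

/-! ### Modes -/

/-- The character with the frequencies of a configuration. -/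
def mode {k : ℕ} (X : Config k) : DensityMatrix k := characterBasis k (signedFreq X.1 X.2)

theorem signedFreq_injective {k : ℕ} :
    Function.Injective fun X : Config k => signedFreq X.1 X.2 := by
  intro X Y h
  ext j c
  · exact congrFun h (Sum.inl j, c)
  · have := congrFun h (Sum.inr j, c)
    simpa [signedFreq] using this

theorem orthonormal_mode (k : ℕ) : Orthonormal ℂ (mode : Config k → DensityMatrix k) :=
  (characterBasis k).orthonormal.comp _ signedFreq_injective

/-- The Fourier coefficient as a continuous linear functional. -/
def coefL {k : ℕ} (X : Config k) : DensityMatrix k →L[ℂ] ℂ := innerSL ℂ (mode X)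

theorem coefL_apply {k : ℕ} (X : Config k) (σ : DensityMatrix k) :
    coefL X σ = fourierCoef σ X.1 X.2 := by
  rw [← characterBasis_repr, HilbertBasis.repr_apply_apply]
  rfl

/-! ### Fourier coefficients and orthonormal families of random density matrices -/

section Random

variable {Ω : Type*} [MeasurableSpace Ω] {P : Measure Ω}

/-- The Fourier coefficient of a random density matrix. -/
def randomCoef (P : Measure Ω) {k : ℕ} (X : Config k) : RandomDensityMatrix P k →L[ℂ] Lp ℂ 2 P :=
  (coefL X).compLpL 2 P

theorem coeFn_randomCoef {k : ℕ} (X : Config k) (θ : RandomDensityMatrix P k) :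
    randomCoef P X θ =ᵐ[P] fun ω => fourierCoef (θ ω) X.1 X.2 := by
  filter_upwards [(coefL X).coeFn_compLpL θ] with ω hω
  rw [randomCoef, hω, coefL_apply]

theorem randomCoef_ext {k : ℕ} {θ θ' : RandomDensityMatrix P k}
    (hθ : ∀ X, randomCoef P X θ = randomCoef P X θ') : θ = θ' := by
  apply Lp.ext
  have : ∀ X : Config k, ∀ᵐ ω ∂P, fourierCoef (θ ω) X.1 X.2 = fourierCoef (θ' ω) X.1 X.2 := by
    intro X
    filter_upwards [coeFn_randomCoef X θ, coeFn_randomCoef X θ'] with ω h1 h2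
    rw [← h1, ← h2, hθ]
  filter_upwards [ae_all_iff.2 this] with ω hω
  exact fourierCoef_ext fun ξ ξ' => hω (ξ, ξ')

/-- The random density matrix with one nonzero Fourier coefficient. -/
def embedMode (P : Measure Ω) {k : ℕ} (X : Config k) : Lp ℂ 2 P →L[ℂ] RandomDensityMatrix P k :=
  (ContinuousLinearMap.toSpanSingleton ℂ (mode X)).compLpL 2 P

theorem coeFn_embedMode {k : ℕ} (X : Config k) (u : Lp ℂ 2 P) :
    embedMode P X u =ᵐ[P] fun ω => u ω • mode X := by
  filter_upwards [(ContinuousLinearMap.toSpanSingleton ℂ (mode X)).coeFn_compLpL u] with ω hω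
  rw [embedMode, hω, ContinuousLinearMap.toSpanSingleton_apply]

theorem randomCoef_embedMode [DecidableEq Freq] {k : ℕ} (X Y : Config k) (u : Lp ℂ 2 P) :
    randomCoef P Y (embedMode P X u) = if X = Y then u else 0 := by
  apply Lp.ext
  have h0 := Lp.coeFn_zero ℂ 2 P
  filter_upwards [coeFn_randomCoef Y (embedMode P X u), coeFn_embedMode X u, h0] with ω h1 h2 h3
  rw [h1, ← coefL_apply, h2, map_smul, coefL, innerSL_apply_apply]
  rw [orthonormal_iff_ite.1 (orthonormal_mode k)]
  by_cases h : X = Y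
  · simp [h]
  · rw [if_neg h, if_neg (Ne.symm h), smul_zero, h3, Pi.zero_apply]

theorem inner_embedMode {k : ℕ} (X Y : Config k) (u v : Lp ℂ 2 P) :
    inner ℂ (embedMode P X u) (embedMode P Y v) = inner ℂ u v * inner ℂ (mode X) (mode Y) := by
  rw [L2.inner_def, L2.inner_def, ← integral_mul_const]
  refine integral_congr_ae ?_
  filter_upwards [coeFn_embedMode X u, coeFn_embedMode Y v] with ω h1 h2
  rw [h1, h2, inner_smul_left, inner_smul_right, RCLike.inner_apply']
  ring

variable [IsProbabilityMeasure P] {h : Freq → Ω → ℝ} (hh : IsBernoulliFamily P h)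

include hh in
theorem memLp_signProd_mul {n k : ℕ} (X : Config k) (F : Config n) :
    MemLp (fun ω => ((signProd h F ω * signProd h X ω : ℝ) : ℂ)) 2 P := by
  refine MemLp.of_bound (Complex.measurable_ofReal.comp
    ((hh.measurable_signProd F).mul (hh.measurable_signProd X))).aestronglyMeasurable 1 ?_
  filter_upwards [hh.ae_mul_self] with ω hω
  have h1 : |signProd h F ω| = 1 := abs_eq_abs.2 (mul_self_eq_one_iff.1 (signProd_mul_self hω F))
    |>.trans abs_one
  have h2 : |signProd h X ω| = 1 := abs_eq_abs.2 (mul_self_eq_one_iff.1 (signProd_mul_self hω X))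
    |>.trans abs_one
  simp [h1, h2]

/-- The product of the random signs of two configurations. -/
def signVec {n k : ℕ} (X : Config k) (F : Config n) : Lp ℂ 2 P :=
  (memLp_signProd_mul hh X F).toLp _

theorem coeFn_signVec {n k : ℕ} (X : Config k) (F : Config n) :
    signVec hh X F =ᵐ[P] fun ω => ((signProd h F ω * signProd h X ω : ℝ) : ℂ) :=
  MemLp.coeFn_toLp _

/-- The factor `D(X)` squares to one in every inner product, so `X` itself may be resonant. -/
theorem orthonormal_signVec {k : ℕ} (X : Config k) (n : ℕ) :
    Orthonormal ℂ fun F : NRConfig n => signVec hh X F.1 := by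
  classical
  rw [orthonormal_iff_ite]
  intro F G
  have hI : inner ℂ (signVec hh X F.1) (signVec hh X G.1) =
      ((∫ ω, signProd h F.1 ω * signProd h G.1 ω ∂P : ℝ) : ℂ) := by
    rw [L2.inner_def, ← integral_complex_ofReal]
    refine integral_congr_ae ?_
    filter_upwards [coeFn_signVec hh X F.1, coeFn_signVec hh X G.1, hh.ae_mul_self] with ω h1 h2 hω
    rw [h1, h2, RCLike.inner_apply', Complex.conj_ofReal, ← Complex.ofReal_mul]
    have := signProd_mul_self hω X
    congr 1
    linear_combination (signProd h F.1 ω * signProd h G.1 ω) * this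
  rw [hI]
  by_cases hFG : F = G
  · subst hFG
    have : ∫ ω, signProd h F.1 ω * signProd h F.1 ω ∂P = ∫ ω, (1 : ℝ) ∂P := by
      refine integral_congr_ae ?_
      filter_upwards [hh.ae_mul_self] with ω hω
      exact signProd_mul_self hω _
    simp [this]
  · rw [hh.integral_signProd_mul_signProd F.2 G.2 fun h => hFG (Subtype.ext h)]
    simp [hFG]

/-- If `R F` and `R G` differ, the characters are orthogonal; if they agree, the random signs are.
Nothing is required of `R`. -/
theorem orthonormal_embedMode_signVec {n k : ℕ} (R : Config n → Config k) :
    Orthonormal ℂ fun F : NRConfig n => embedMode P (R F.1) (signVec hh (R F.1) F.1) := by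
  classical
  rw [orthonormal_iff_ite]
  intro F G
  rw [inner_embedMode, orthonormal_iff_ite.1 (orthonormal_mode k)]
  by_cases hR : R F.1 = R G.1
  · rw [hR, orthonormal_iff_ite.1 (orthonormal_signVec hh (R G.1) n)]
    simp
  · have : F ≠ G := fun h => hR (by rw [h])
    simp [hR, this]

end Random

/-- The isometry of `ℓ²` into a Hilbert space that is given by an orthonormal family. -/
def _root_.Orthonormal.isometry {ι E : Type*} [NormedAddCommGroup E] [InnerProductSpace ℂ E]
    [CompleteSpace E] {v : ι → E} (hv : Orthonormal ℂ v) : lp (fun _ : ι => ℂ) 2 →ₗᵢ[ℂ] E :=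
  hv.orthogonalFamily.linearIsometry

theorem _root_.Orthonormal.hasSum_isometry {ι E : Type*} [NormedAddCommGroup E]
    [InnerProductSpace ℂ E] [CompleteSpace E] {v : ι → E} (hv : Orthonormal ℂ v)
    (f : lp (fun _ : ι => ℂ) 2) : HasSum (fun i => f i • v i) (hv.isometry f) := by
  unfold Orthonormal.isometry
  simpa using hv.orthogonalFamily.hasSum_linearIsometry f

/-! ### The action of collisions on synthesized random density matrices -/

section Synthesis

variable {Ω : Type*} [MeasurableSpace Ω] {P : Measure Ω} [IsProbabilityMeasure P]
  {h : Freq → Ω → ℝ} (hh : IsBernoulliFamily P h)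

/-- The random density matrix `∑_F f(F) D(F) D(R F) e_{R F}`, where `D` is the product of the
random signs. -/
def synth {n k : ℕ} (R : Config n → Config k) :
    lp (fun _ : NRConfig n => ℂ) 2 →ₗᵢ[ℂ] RandomDensityMatrix P k :=
  (orthonormal_embedMode_signVec hh R).isometry

/-- The random variable `∑_F f(F) D(F) D(X)`. -/
def signSynth {n k : ℕ} (X : Config k) : lp (fun _ : NRConfig n => ℂ) 2 →ₗᵢ[ℂ] Lp ℂ 2 P :=
  (orthonormal_signVec hh X n).isometry

theorem randomCoef_synth {n k : ℕ} (R : Config n → Config k) (X : Config k)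
    (f : lp (fun _ : NRConfig n => ℂ) 2) :
    randomCoef P X (synth hh R f) = signSynth hh X (restrictTo {F | R F.1 = X} f) := by
  classical
  have h1 := ((orthonormal_embedMode_signVec hh R).hasSum_isometry f).mapL (randomCoef P X)
  have h2 := (orthonormal_signVec hh X n).hasSum_isometry (restrictTo {F | R F.1 = X} f)
  refine h1.unique ?_
  unfold signSynth
  convert h2 using 2 with F
  rw [map_smul, randomCoef_embedMode, restrictTo_apply, Set.indicator_apply]
  by_cases hF : R F.1 = X
  · simp [hF]
  · simp [hF]

include hh in
theorem memLp_collisionSign (s : Bool) {k : ℕ} (j : Fin k) (X : Config k) (p : Freq × Freq) :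
    MemLp (fun ω => ((collisionSign h s j X p ω : ℝ) : ℂ)) ∞ P := by
  refine memLp_top_of_bound (Complex.measurable_ofReal.comp
    (hh.measurable_collisionSign s j X p)).aestronglyMeasurable 1 ?_
  filter_upwards [hh.ae_mul_self] with ω hω
  have h1 : |collisionSign h s j X p ω| = 1 :=
    (abs_eq_abs.2 (mul_self_eq_one_iff.1 (collisionSign_mul_self hω s j X p))).trans abs_one
  simp [h1]

/-- The summand with index `p` of the series for the coefficient of `B^±_{j,k+1} σ` at `X`. -/
def collisionTermL (s : Bool) {k : ℕ} (j : Fin k) (X : Config k) (p : Freq × Freq) :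
    RandomDensityMatrix P (k + 1) →L[ℂ] Lp ℂ 2 P :=
  ((ContinuousLinearMap.mul ℂ ℂ).holderL P ∞ 2 2
    ((memLp_collisionSign hh s j X p).toLp _)).comp (randomCoef P (expand s j X p))

theorem coeFn_holderL_collisionSign (s : Bool) {k : ℕ} (j : Fin k) (X : Config k)
    (p : Freq × Freq) (u : Lp ℂ 2 P) :
    (ContinuousLinearMap.mul ℂ ℂ).holderL P ∞ 2 2 ((memLp_collisionSign hh s j X p).toLp _) u =ᵐ[P]
      fun ω => (collisionSign h s j X p ω : ℂ) * u ω := by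
  filter_upwards [(ContinuousLinearMap.mul ℂ ℂ).coeFn_holder (r := 2)
    ((memLp_collisionSign hh s j X p).toLp _) u, (memLp_collisionSign hh s j X p).coeFn_toLp]
    with ω h1 h2
  rw [ContinuousLinearMap.holderL_apply_apply, h1, h2]
  rfl

theorem coeFn_collisionTermL (s : Bool) {k : ℕ} (j : Fin k) (X : Config k) (p : Freq × Freq)
    (σ : RandomDensityMatrix P (k + 1)) :
    collisionTermL hh s j X p σ =ᵐ[P] fun ω => (collisionSign h s j X p ω : ℂ) *
      fourierCoef (σ ω) (expand s j X p).1 (expand s j X p).2 := by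
  filter_upwards [coeFn_holderL_collisionSign hh s j X p (randomCoef P (expand s j X p) σ),
    coeFn_randomCoef (expand s j X p) σ] with ω h1 h2
  rw [collisionTermL, ContinuousLinearMap.comp_apply, h1, h2]

/-- Multiplication by the collision sign turns `D(F) D(Y)`, with `Y` the expanded configuration,
into `D(F) D(X)`; the summand with index `p` is the part of the fibre above `X` with last pair `p`.
-/
theorem collisionTermL_synth (s : Bool) {n k : ℕ} (j : Fin k) (X : Config k) (p : Freq × Freq)
    (R : Config n → Config (k + 1)) (f : lp (fun _ : NRConfig n => ℂ) 2) :
    collisionTermL hh s j X p (synth hh R f) =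
      signSynth hh X (restrictTo {F | F ∈ {F : NRConfig n | contract s j (R F.1) = X} ∧
        lastPair (R F.1) = p} f) := by
  have hset : {F : NRConfig n | R F.1 = expand s j X p} =
      {F | F ∈ {F : NRConfig n | contract s j (R F.1) = X} ∧ lastPair (R F.1) = p} :=
    Set.ext fun F => expand_eq_iff
  rw [collisionTermL, ContinuousLinearMap.comp_apply, randomCoef_synth, hset]
  generalize restrictTo _ f = g
  have h1 := ((orthonormal_signVec hh (expand s j X p) n).hasSum_isometry g).mapL
    ((ContinuousLinearMap.mul ℂ ℂ).holderL P ∞ 2 2 ((memLp_collisionSign hh s j X p).toLp _))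
  refine h1.unique ?_
  unfold signSynth
  convert (orthonormal_signVec hh X n).hasSum_isometry g using 2 with F
  rw [map_smul]
  congr 1
  apply Lp.ext
  filter_upwards [coeFn_holderL_collisionSign hh s j X p (signVec hh (expand s j X p) F.1),
    coeFn_signVec hh (expand s j X p) F.1, coeFn_signVec hh X F.1, hh.ae_mul_self]
    with ω h1 h2 h3 hω
  rw [h1, h2, h3, ← Complex.ofReal_mul, ← collisionSign_mul_signProd hω s j X p]
  congr 1
  ring

/-- A collision keeps the coefficients `f` and only composes the frequency map with `contract`, so
the class of synthesized matrices is stable under it. -/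
theorem hasSum_collisionTermL_synth (s : Bool) {n k : ℕ} (j : Fin k) (X : Config k)
    (R : Config n → Config (k + 1)) (f : lp (fun _ : NRConfig n => ℂ) 2) :
    HasSum (fun p => collisionTermL hh s j X p (synth hh R f))
      (randomCoef P X (synth hh (contract s j ∘ R) f)) := by
  simp only [collisionTermL_synth, randomCoef_synth]
  exact (hasSum_restrictTo_fiber (fun F : NRConfig n => lastPair (R F.1))
    {F | contract s j (R F.1) = X} f).mapL (signSynth hh X).toContinuousLinearMap

/-- Uniformity in the finite set `S` is what later allows summation over histories under the series
in `p`. -/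
theorem norm_sum_collisionTermL_synth_le (s : Bool) {n k : ℕ} (j : Fin k) (X : Config k)
    (R : Config n → Config (k + 1)) (f : lp (fun _ : NRConfig n => ℂ) 2)
    (S : Finset (Freq × Freq)) :
    ‖∑ p ∈ S, collisionTermL hh s j X p (synth hh R f)‖ ≤ ‖f‖ := by
  simp only [collisionTermL_synth]
  rw [← map_sum, sum_restrictTo_fiber (fun F : NRConfig n => lastPair (R F.1))
    {F | contract s j (R F.1) = X}, LinearIsometry.norm_map]
  exact norm_restrictTo_le _ _

end Synthesis

/-! ### Minkowski's inequality for series -/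

theorem lp_two_enorm_sq {ι : Type*} (f : lp (fun _ : ι => ℂ) 2) :
    ‖f‖ₑ ^ 2 = ∑' i, ‖f i‖ₑ ^ 2 := by
  have h := lp.hasSum_norm (p := 2) (by norm_num) f
  have h2 : HasSum (fun i => ‖f i‖ ^ 2) (‖f‖ ^ 2) := by simpa using h
  have h3 := ENNReal.ofReal_tsum_of_nonneg (fun i => sq_nonneg ‖f i‖) h2.summable
  rw [h2.tsum_eq, ENNReal.ofReal_pow (norm_nonneg _), ofReal_norm] at h3
  rw [h3]
  refine tsum_congr fun i => ?_
  rw [ENNReal.ofReal_pow (norm_nonneg _), ofReal_norm]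

theorem l2norm_add_le {κ : Type*} (a b : κ → ℝ≥0∞) :
    (∑' x, (a x + b x) ^ 2) ^ (1 / 2 : ℝ) ≤
      (∑' x, a x ^ 2) ^ (1 / 2 : ℝ) + (∑' x, b x ^ 2) ^ (1 / 2 : ℝ) := by
  let _ : MeasurableSpace κ := ⊤
  have h := ENNReal.lintegral_Lp_add_le (μ := Measure.count) (f := a) (g := b) (p := 2)
    measurable_from_top.aemeasurable measurable_from_top.aemeasurable (by norm_num)
  simpa [lintegral_count, ENNReal.rpow_two] using h

theorem l2norm_sum_le {ι κ : Type*} (s : Finset ι) (a : ι → κ → ℝ≥0∞) :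
    (∑' x, (∑ i ∈ s, a i x) ^ 2) ^ (1 / 2 : ℝ) ≤ ∑ i ∈ s, (∑' x, a i x ^ 2) ^ (1 / 2 : ℝ) := by
  classical
  induction s using Finset.induction_on with
  | empty => simp
  | insert i s hi ih =>
    simp only [Finset.sum_insert hi]
    exact (l2norm_add_le _ _).trans (add_le_add le_rfl ih)

/-- Finite Minkowski, passed to the limit first in the summands over a fixed finite set of
coordinates and then in that set. -/
theorem l2norm_tsum_le {ι κ : Type*} (a : ι → κ → ℝ≥0∞) :
    (∑' x, (∑' i, a i x) ^ 2) ^ (1 / 2 : ℝ) ≤ ∑' i, (∑' x, a i x ^ 2) ^ (1 / 2 : ℝ) := by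
  set C := ∑' i, (∑' x, a i x ^ 2) ^ (1 / 2 : ℝ)
  rw [one_div, ENNReal.rpow_inv_le_iff (by norm_num), ENNReal.rpow_two,
    ENNReal.tsum_eq_iSup_sum]
  refine iSup_le fun t => ?_
  have hlim : Tendsto (fun s : Finset ι => ∑ x ∈ t, (∑ i ∈ s, a i x) ^ 2) atTop
      (𝓝 (∑ x ∈ t, (∑' i, a i x) ^ 2)) :=
    tendsto_finsetSum _ fun x _ =>
      ((ENNReal.continuous_pow 2).tendsto _).comp ENNReal.summable.hasSum
  refine le_of_tendsto' hlim fun s => ?_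
  refine (ENNReal.sum_le_tsum t).trans ?_
  rw [← ENNReal.rpow_two, ← ENNReal.rpow_inv_le_iff (by norm_num), ← one_div]
  exact (l2norm_sum_le s a).trans (ENNReal.sum_le_tsum s)

/-! ### Sobolev norms of random density matrices -/

section Random

variable {Ω : Type*} [MeasurableSpace Ω] {P : Measure Ω}

theorem enorm_sq_eq_lintegral (u : Lp ℂ 2 P) : ‖u‖ₑ ^ 2 = ∫⁻ ω, ‖u ω‖ₑ ^ 2 ∂P := by
  rw [Lp.enorm_def, eLpNorm_eq_lintegral_rpow_enorm_toReal (by norm_num) (by norm_num),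
    ← ENNReal.rpow_natCast, ← ENNReal.rpow_mul]
  norm_num

/-- Tonelli: the expectation is exchanged with the sum over frequencies. -/
theorem randomSobolevNorm_eq {k : ℕ} (α : ℝ) (θ : RandomDensityMatrix P k) :
    randomSobolevNorm α θ =
      (∑' X : Config k, (ENNReal.ofReal (weight α X) * ‖randomCoef P X θ‖ₑ) ^ 2) ^
        (1 / 2 : ℝ) := by
  rw [randomSobolevNorm]
  congr 1
  have h1 : ∀ ω, sobolevNorm α (θ ω) ^ 2 = ∑' X : Config k,
      (ENNReal.ofReal (weight α X) * ‖fourierCoef (θ ω) X.1 X.2‖ₑ) ^ 2 := by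
    intro ω
    rw [sobolevNorm, ← ENNReal.rpow_natCast, ← ENNReal.rpow_mul]
    norm_num
  simp only [h1]
  rw [lintegral_tsum]
  · refine tsum_congr fun X => ?_
    rw [mul_pow, enorm_sq_eq_lintegral, ← lintegral_const_mul' _ _ (by finiteness)]
    refine lintegral_congr_ae ?_
    filter_upwards [coeFn_randomCoef X θ] with ω hω
    rw [hω, mul_pow]
  · intro X
    exact ((aestronglyMeasurable_fourierCoef θ X.1 X.2).enorm.const_mul _).pow_const _

theorem randomSobolevNorm_zero {k : ℕ} (α : ℝ) :
    randomSobolevNorm α (0 : RandomDensityMatrix P k) = 0 := by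
  simp [randomSobolevNorm_eq]

theorem randomSobolevNorm_le_tsum {ι : Type*} {k : ℕ} (α : ℝ) {θ : RandomDensityMatrix P k}
    {θs : ι → RandomDensityMatrix P k} (hθ : HasSum θs θ) :
    randomSobolevNorm α θ ≤ ∑' i, randomSobolevNorm α (θs i) := by
  simp only [randomSobolevNorm_eq]
  refine le_trans ?_ (l2norm_tsum_le _)
  refine ENNReal.rpow_le_rpow (ENNReal.tsum_le_tsum fun X => ?_) (by norm_num)
  rw [ENNReal.tsum_mul_left]
  gcongr
  rw [← (hθ.mapL (randomCoef P X)).tsum_eq]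
  exact enorm_tsum_le_tsum_enorm

/-! ### The free evolution of random density matrices -/

/-- The symbol `|ξ_1|² + ⋯ + |ξ_k|² - |ξ'_1|² - ⋯ - |ξ'_k|²`. -/
def energy {k : ℕ} (X : Config k) : ℝ := (∑ j, freqSq (X.1 j)) - ∑ j, freqSq (X.2 j)

/-- The factor `e^{-it(|ξ|² - |ξ'|²)}` of the free evolution. -/
def phase {k : ℕ} (t : ℝ) (X : Config k) : ℂ :=
  Complex.exp ((-(t * energy X) : ℝ) * Complex.I)

theorem norm_phase {k : ℕ} (t : ℝ) (X : Config k) : ‖phase t X‖ = 1 :=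
  Complex.norm_exp_ofReal_mul_I _

theorem phase_add {k : ℕ} (t s : ℝ) (X : Config k) : phase (t + s) X = phase t X * phase s X := by
  rw [phase, phase, phase, ← Complex.exp_add]
  congr 1
  push_cast
  ring

theorem continuous_phase {k : ℕ} (X : Config k) : Continuous fun t => phase t X := by
  unfold phase
  fun_prop

theorem randomCoef_freeEvolution {k : ℕ} (t : ℝ) (X : Config k) (θ : RandomDensityMatrix P k) :
    randomCoef P X ((freeEvolution k t).compLp θ) = phase t X • randomCoef P X θ := by
  apply Lp.ext
  filter_upwards [coeFn_randomCoef X ((freeEvolution k t).compLp θ), coeFn_randomCoef X θ,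
    (freeEvolution k t).coeFn_compLp θ, Lp.coeFn_smul (phase t X) (randomCoef P X θ)]
    with ω h1 h2 h3 h4
  rw [h1, h3, h4, Pi.smul_apply, h2, fourierCoef_freeEvolution, smul_eq_mul]
  rfl

/-- The free evolution on coefficients with respect to `synth R`. -/
def phaseMul {n k : ℕ} (R : Config n → Config k) (t : ℝ) :
    lp (fun _ : NRConfig n => ℂ) 2 →L[ℂ] lp (fun _ : NRConfig n => ℂ) 2 :=
  diagMul (fun F => phase t (R F.1)) fun F => (norm_phase t (R F.1)).le

variable [IsProbabilityMeasure P] {h : Freq → Ω → ℝ} (hh : IsBernoulliFamily P h)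

/-- The term of `F` lives on the single character at `R F`, so the evolution multiplies `f(F)` by
the phase there. -/
theorem freeEvolution_synth {n k : ℕ} (R : Config n → Config k) (t : ℝ)
    (f : lp (fun _ : NRConfig n => ℂ) 2) :
    (freeEvolution k t).compLp (synth hh R f) = synth hh R (phaseMul R t f) := by
  refine randomCoef_ext fun X => ?_
  rw [randomCoef_freeEvolution, randomCoef_synth, randomCoef_synth, ← map_smul]
  congr 1
  ext F
  rw [lp.coeFn_smul, Pi.smul_apply, restrictTo_apply, restrictTo_apply]
  by_cases hF : R F.1 = X
  · simp [hF, phaseMul]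
  · simp [hF]

theorem randomCoef_const {k : ℕ} (X : Config k) (σ : DensityMatrix k) :
    randomCoef P X (Lp.const 2 P σ) = Lp.const 2 P (fourierCoef σ X.1 X.2) := by
  apply Lp.ext
  filter_upwards [coeFn_randomCoef X (Lp.const 2 P σ), Lp.coeFn_const 2 P σ,
    Lp.coeFn_const 2 P (fourierCoef σ X.1 X.2)] with ω h1 h2 h3
  rw [h1, h2, h3]
  rfl

/-- For `R = id` the signs `D(F) D(F)` cancel. Deterministic non-resonant data thus start the
iteration within the synthesized class. -/
theorem const_eq_synth {n : ℕ} (σ : DensityMatrix n)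
    (hσ : ∀ X : Config n, ¬ NonresonantOrder X.1 X.2 → fourierCoef σ X.1 X.2 = 0)
    (f : lp (fun _ : NRConfig n => ℂ) 2) (hf : ∀ F, f F = fourierCoef σ F.1.1 F.1.2) :
    Lp.const 2 P σ = synth hh id f := by
  classical
  refine randomCoef_ext fun X => ?_
  rw [randomCoef_const, randomCoef_synth]
  have h1 := (orthonormal_signVec hh X n).hasSum_isometry (restrictTo {F | id F.1 = X} f)
  by_cases hX : NonresonantOrder X.1 X.2
  · have h2 := hasSum_single (f := fun F : NRConfig n =>
      restrictTo {F : NRConfig n | id F.1 = X} f F • signVec hh X F.1) ⟨X, hX⟩ (by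
        intro F hF
        have : F.1 ≠ X := fun h => hF (Subtype.ext h)
        simp [restrictTo_apply, this])
    have h3 := h1.unique h2
    rw [signSynth, h3]
    simp only [restrictTo_apply, Set.indicator_apply, Set.mem_ofPred_eq, id, if_true, hf]
    apply Lp.ext
    filter_upwards [Lp.coeFn_smul (fourierCoef σ X.1 X.2) (signVec hh X X), coeFn_signVec hh X X,
      Lp.coeFn_const 2 P (fourierCoef σ X.1 X.2), hh.ae_mul_self] with ω e1 e2 e3 hω
    rw [e1, Pi.smul_apply, e2, e3, signProd_mul_self hω]
    simp
  · have hz : restrictTo {F : NRConfig n | id F.1 = X} f = 0 := by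
      ext F
      have : F.1 ≠ X := fun h => hX (h ▸ F.2)
      simp [restrictTo_apply, this]
    rw [hz, map_zero, hσ X hX, map_zero]

/-! ### The collision operators of series -/

theorem hasFourierSeries_of_hasSum (s : Bool) {k : ℕ} (j : Fin k)
    {σ : RandomDensityMatrix P (k + 1)} {θ : RandomDensityMatrix P k}
    {term : (Fin k → Freq) → (Fin k → Freq) → Freq × Freq → Ω → ℂ}
    (hterm : ∀ (X : Config k) (p : Freq × Freq) (ω : Ω), term X.1 X.2 p ω =
      (collisionSign h s j X p ω : ℂ) *
        fourierCoef (σ ω) (expand s j X p).1 (expand s j X p).2)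
    (hs : ∀ X, HasSum (fun p => collisionTermL hh s j X p σ) (randomCoef P X θ)) :
    HasFourierSeries P term θ := by
  intro ξ ξ'
  have h1 : Tendsto (fun F : Finset (Freq × Freq) => ‖randomCoef P (ξ, ξ') θ -
      ∑ p ∈ F, collisionTermL hh s j (ξ, ξ') p σ‖ₑ) atTop (𝓝 0) := by
    have h0 := (tendsto_const_nhds (x := randomCoef P (ξ, ξ') θ)).sub (hs (ξ, ξ'))
    rw [sub_self] at h0
    simpa using h0.enorm
  refine h1.congr fun F => ?_
  rw [Lp.enorm_def]
  refine eLpNorm_congr_ae ?_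
  have hF : ∀ p, ∀ᵐ ω ∂P, collisionTermL hh s j (ξ, ξ') p σ ω = term ξ ξ' p ω := fun p => by
    filter_upwards [coeFn_collisionTermL hh s j (ξ, ξ') p σ] with ω hω
    rw [hω, hterm (ξ, ξ')]
  filter_upwards [Lp.coeFn_sub (randomCoef P (ξ, ξ') θ)
      (∑ p ∈ F, collisionTermL hh s j (ξ, ξ') p σ), coeFn_randomCoef (ξ, ξ') θ,
    Lp.coeFn_fun_finsetSum F fun p => collisionTermL hh s j (ξ, ξ') p σ,
    ae_all_iff.2 hF] with ω e1 e2 e3 e4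
  rw [e1, Pi.sub_apply, e2, e3]
  simp only [e4]

include hh in
theorem aestronglyMeasurable_term (s : Bool) {k : ℕ} (j : Fin k)
    {σ : RandomDensityMatrix P (k + 1)}
    {term : (Fin k → Freq) → (Fin k → Freq) → Freq × Freq → Ω → ℂ}
    (hterm : ∀ (X : Config k) (p : Freq × Freq) (ω : Ω), term X.1 X.2 p ω =
      (collisionSign h s j X p ω : ℂ) *
        fourierCoef (σ ω) (expand s j X p).1 (expand s j X p).2)
    (ξ ξ' : Fin k → Freq) (p : Freq × Freq) : AEStronglyMeasurable (term ξ ξ' p) P :=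
  ((Lp.aestronglyMeasurable (collisionTermL hh s j (ξ, ξ') p σ)).congr
    (coeFn_collisionTermL hh s j (ξ, ξ') p σ)).congr
      (.of_forall fun ω => (hterm (ξ, ξ') p ω).symm)

/-- Uniqueness of the random density matrix with a given series identifies the chosen value. -/
theorem collisionPlus_eq {k : ℕ} (j : Fin k) {σ : RandomDensityMatrix P (k + 1)}
    {θ : RandomDensityMatrix P k}
    (hs : ∀ X, HasSum (fun p => collisionTermL hh true j X p σ) (randomCoef P X θ)) :
    CollisionPlusDefined h j σ ∧ collisionPlus h j σ = θ := by
  have hterm : ∀ (X : Config k) (p : Freq × Freq) (ω : Ω),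
      collisionPlusTerm h j σ X.1 X.2 p ω = (collisionSign h true j X p ω : ℂ) *
        fourierCoef (σ ω) (expand true j X p).1 (expand true j X p).2 := fun _ _ _ => rfl
  have hθ := hasFourierSeries_of_hasSum hh true j hterm hs
  have hd : CollisionPlusDefined h j σ := ⟨θ, hθ⟩
  refine ⟨hd, ?_⟩
  rw [collisionPlus, dif_pos hd]
  exact HasFourierSeries.unique (aestronglyMeasurable_term hh true j hterm) hd.choose_spec hθ

theorem collisionMinus_eq {k : ℕ} (j : Fin k) {σ : RandomDensityMatrix P (k + 1)}
    {θ : RandomDensityMatrix P k}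
    (hs : ∀ X, HasSum (fun p => collisionTermL hh false j X p σ) (randomCoef P X θ)) :
    CollisionMinusDefined h j σ ∧ collisionMinus h j σ = θ := by
  have hterm : ∀ (X : Config k) (p : Freq × Freq) (ω : Ω),
      collisionMinusTerm h j σ X.1 X.2 p ω = (collisionSign h false j X p ω : ℂ) *
        fourierCoef (σ ω) (expand false j X p).1 (expand false j X p).2 := fun _ _ _ => rfl
  have hθ := hasFourierSeries_of_hasSum hh false j hterm hs
  have hd : CollisionMinusDefined h j σ := ⟨θ, hθ⟩
  refine ⟨hd, ?_⟩
  rw [collisionMinus, dif_pos hd]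
  exact HasFourierSeries.unique (aestronglyMeasurable_term hh false j hterm) hd.choose_spec hθ

/-- Each summand in `p` is continuous and commutes with the sum over `i`. The partial sums in `p`
are bounded by `‖f i‖`, so dominated convergence exchanges the two limits without a bound for the
collision operator on the whole space. -/
theorem hasSum_collisionTermL {ι : Type*} (s : Bool) {k : ℕ} (j : Fin k) {n : ι → ℕ}
    (R : ∀ i, Config (n i) → Config (k + 1)) (f : ∀ i, lp (fun _ : NRConfig (n i) => ℂ) 2)
    (hf : Summable fun i => ‖f i‖) (X : Config k) :
    HasSum (fun p => collisionTermL hh s j X p (∑' i, synth hh (R i) (f i)))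
      (randomCoef P X (∑' i, synth hh (contract s j ∘ R i) (f i))) := by
  have hsum : ∀ {m : ℕ} (Q : ∀ i, Config (n i) → Config m),
      Summable fun i => synth hh (Q i) (f i) := fun Q =>
    Summable.of_norm (by simpa using hf)
  have hT : ∀ p, collisionTermL hh s j X p (∑' i, synth hh (R i) (f i)) =
      ∑' i, collisionTermL hh s j X p (synth hh (R i) (f i)) := fun p =>
    (collisionTermL hh s j X p).map_tsum (hsum R)
  rw [(randomCoef P X).map_tsum (hsum _)]
  simp only [hT]
  rw [HasSum]
  have hsw : ∀ S : Finset (Freq × Freq),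
      ∑ p ∈ S, ∑' i, collisionTermL hh s j X p (synth hh (R i) (f i)) =
      ∑' i, ∑ p ∈ S, collisionTermL hh s j X p (synth hh (R i) (f i)) := fun S =>
    (Summable.tsum_finsetSum fun p _ => (collisionTermL hh s j X p).summable (hsum R)).symm
  simp only [hsw]
  exact tendsto_tsum_of_dominated_convergence hf
    (fun i => hasSum_collisionTermL_synth hh s j X (R i) (f i))
    (.of_forall fun S i => norm_sum_collisionTermL_synth_le hh s j X (R i) (f i) S)

/-! ### Sobolev norms of synthesized random density matrices -/

/-- Division by the Sobolev weight. -/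
def unweight {α : ℝ} (hα : 0 ≤ α) (n : ℕ) :
    lp (fun _ : NRConfig n => ℂ) 2 →L[ℂ] lp (fun _ : NRConfig n => ℂ) 2 :=
  diagMul (fun F => (((weight α F.1)⁻¹ : ℝ) : ℂ)) fun F => by
    have h1 := one_le_sobolevWeight hα F.1.1 F.1.2
    rw [Complex.norm_real, Real.norm_of_nonneg (inv_nonneg.2 (zero_le_one.trans h1))]
    exact inv_le_one_of_one_le₀ h1

/-- By orthogonality the squared coefficient at `X` is a sum over the fibre of `R` above `X`. After
exchanging sums, each `F` contributes once, at `R F`, where the weight is at most `K` times the one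
divided out. -/
theorem randomSobolevNorm_synth_unweight_le {α : ℝ} (hα : 0 ≤ α) {n k : ℕ}
    (R : Config n → Config k) {K : ℝ} (hR : ∀ F, weight α (R F) ≤ K * weight α F)
    (g : lp (fun _ : NRConfig n => ℂ) 2) :
    randomSobolevNorm α (synth hh R (unweight hα n g)) ≤ ENNReal.ofReal K * ‖g‖ₑ := by
  classical
  have hw : ∀ {m : ℕ} (X : Config m), 0 < weight α X := fun X =>
    zero_lt_one.trans_le (one_le_sobolevWeight hα X.1 X.2)
  have h1 : ∀ X : Config k,
      (ENNReal.ofReal (weight α X) * ‖randomCoef P X (synth hh R (unweight hα n g))‖ₑ) ^ 2 =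
      ∑' F : NRConfig n, if R F.1 = X then
        (ENNReal.ofReal (weight α X) * ‖unweight hα n g F‖ₑ) ^ 2 else 0 := by
    intro X
    rw [randomCoef_synth, mul_pow]
    have : ‖signSynth hh X (restrictTo {F : NRConfig n | R F.1 = X} (unweight hα n g))‖ₑ =
        ‖restrictTo {F : NRConfig n | R F.1 = X} (unweight hα n g)‖ₑ := by
      rw [← ofReal_norm, LinearIsometry.norm_map, ofReal_norm]
    rw [this, lp_two_enorm_sq, ← ENNReal.tsum_mul_left]
    refine tsum_congr fun F => ?_
    rw [restrictTo_apply, Set.indicator_apply]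
    by_cases hF : R F.1 = X <;> simp [hF, mul_pow]
  rw [randomSobolevNorm_eq]
  simp only [h1]
  rw [ENNReal.tsum_comm]
  have h2 : ∀ F : NRConfig n, (∑' X : Config k, if R F.1 = X then
      (ENNReal.ofReal (weight α X) * ‖unweight hα n g F‖ₑ) ^ 2 else 0) ≤
      ENNReal.ofReal K ^ 2 * ‖g F‖ₑ ^ 2 := by
    intro F
    rw [tsum_eq_single (R F.1) fun X hX => if_neg (Ne.symm hX), if_pos rfl, ← mul_pow]
    refine pow_le_pow_left' ?_ 2
    have h3 : ‖unweight hα n g F‖ₑ = ENNReal.ofReal ((weight α F.1)⁻¹) * ‖g F‖ₑ := by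
      rw [unweight, diagMul_apply, enorm_mul, ← ofReal_norm, Complex.norm_real,
        Real.norm_of_nonneg (inv_nonneg.2 (hw _).le)]
    rw [h3, ← mul_assoc, ← ENNReal.ofReal_mul (hw _).le]
    gcongr
    rw [← div_eq_mul_inv, div_le_iff₀ (hw _)]
    exact hR _
  calc _ ≤ (∑' F : NRConfig n, ENNReal.ofReal K ^ 2 * ‖g F‖ₑ ^ 2) ^ (1 / 2 : ℝ) :=
        ENNReal.rpow_le_rpow (ENNReal.tsum_le_tsum h2) (by norm_num)
    _ = ENNReal.ofReal K * ‖g‖ₑ := by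
        rw [ENNReal.tsum_mul_left, ← lp_two_enorm_sq, ← mul_pow, ← ENNReal.rpow_natCast,
          ← ENNReal.rpow_mul]
        norm_num

end Random

/-! ### Strong continuity of the free evolution -/

theorem continuous_phaseMul_apply {n k : ℕ} (R : Config n → Config k)
    (f : lp (fun _ : NRConfig n => ℂ) 2) : Continuous fun t => phaseMul R t f := by
  rw [continuous_iff_continuousAt]
  intro t₀
  rw [ContinuousAt, tendsto_iff_norm_sub_tendsto_zero]
  have h2 : 0 < (2 : ℝ≥0∞).toReal := by norm_num
  have hf : Summable fun F => ‖f F‖ ^ 2 := by simpa using (lp.hasSum_norm h2 f).summable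
  have hsq : ∀ t, ‖phaseMul R t f - phaseMul R t₀ f‖ ^ 2 =
      ∑' F : NRConfig n, (‖phase t (R F.1) - phase t₀ (R F.1)‖ * ‖f F‖) ^ 2 := by
    intro t
    have := (lp.hasSum_norm h2 (phaseMul R t f - phaseMul R t₀ f)).tsum_eq
    simp only [ENNReal.toReal_ofNat, Real.rpow_two] at this
    rw [← this]
    refine tsum_congr fun F => ?_
    rw [lp.coeFn_sub, Pi.sub_apply, phaseMul, phaseMul, diagMul_apply, diagMul_apply, ← sub_mul,
      norm_mul]
  have hlim : Tendsto (fun t => ‖phaseMul R t f - phaseMul R t₀ f‖ ^ 2) (𝓝 t₀) (𝓝 0) := by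
    simp only [hsq]
    have h0 : ∑' _ : NRConfig n, (0 : ℝ) = 0 := tsum_zero
    rw [← h0]
    -- Two unimodular phases differ by at most `2`, whence the factor `4` for squares.
    refine tendsto_tsum_of_dominated_convergence (hf.mul_left 4) (fun F => ?_)
      (.of_forall fun t F => ?_)
    · have h1 : Tendsto (fun t => phase t (R F.1)) (𝓝 t₀) (𝓝 (phase t₀ (R F.1))) :=
        (continuous_phase (R F.1)).tendsto t₀
      have h3 := (((tendsto_iff_norm_sub_tendsto_zero.1 h1).mul_const ‖f F‖).pow 2)
      simpa using h3
    · rw [Real.norm_of_nonneg (sq_nonneg _), mul_pow]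
      have h4 : ‖phase t (R F.1) - phase t₀ (R F.1)‖ ≤ 2 :=
        (norm_sub_le _ _).trans (by rw [norm_phase, norm_phase]; norm_num)
      have : ‖phase t (R F.1) - phase t₀ (R F.1)‖ ^ 2 ≤ 2 ^ 2 :=
        pow_le_pow_left₀ (norm_nonneg _) h4 2
      nlinarith [sq_nonneg ‖f F‖]
  have := hlim.sqrt
  simpa using this

theorem norm_phaseMul_le {n k : ℕ} (R : Config n → Config k) (t : ℝ)
    (f : lp (fun _ : NRConfig n => ℂ) 2) : ‖phaseMul R t f‖ ≤ ‖f‖ :=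
  norm_diagMul_le _ _ f

theorem phaseMul_sub {n k : ℕ} (R : Config n → Config k) (t r : ℝ)
    (f : lp (fun _ : NRConfig n => ℂ) 2) :
    phaseMul R (t - r) f = phaseMul R t (phaseMul R (-r) f) := by
  ext F
  simp only [phaseMul, diagMul_apply, sub_eq_add_neg, phase_add, mul_assoc]

/-- Strong continuity and the uniform bound by one give joint continuity. -/
theorem continuous_phaseMul {n k : ℕ} (R : Config n → Config k) {τ : ℝ → ℝ} (hτ : Continuous τ)
    {g : ℝ → lp (fun _ : NRConfig n => ℂ) 2} (hg : Continuous g) :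
    Continuous fun t => phaseMul R (τ t) (g t) := by
  rw [continuous_iff_continuousAt]
  intro t₀
  rw [ContinuousAt, tendsto_iff_norm_sub_tendsto_zero]
  have h1 : Tendsto (fun t => ‖g t - g t₀‖) (𝓝 t₀) (𝓝 0) :=
    tendsto_iff_norm_sub_tendsto_zero.1 (hg.tendsto t₀)
  have h2 : Tendsto (fun t => ‖phaseMul R (τ t) (g t₀) - phaseMul R (τ t₀) (g t₀)‖) (𝓝 t₀)
      (𝓝 0) :=
    tendsto_iff_norm_sub_tendsto_zero.1
      (((continuous_phaseMul_apply R (g t₀)).comp hτ).tendsto t₀)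
  refine squeeze_zero (fun _ => norm_nonneg _) (fun t => ?_) (by simpa using h1.add h2)
  calc ‖phaseMul R (τ t) (g t) - phaseMul R (τ t₀) (g t₀)‖
      = ‖phaseMul R (τ t) (g t - g t₀) +
          (phaseMul R (τ t) (g t₀) - phaseMul R (τ t₀) (g t₀))‖ := by
        rw [map_sub]
        congr 1
        abel
    _ ≤ _ := (norm_add_le _ _).trans (add_le_add (norm_phaseMul_le _ _ _) le_rfl)

/-! ### Collision histories -/

/-- The order (minus one) of the density matrix from which `ℓ` collisions lead to order `k + 1`. -/
@[reducible]
def initialOrder : ℕ → ℕ → ℕ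
  | 0, k => k
  | ℓ + 1, k => initialOrder ℓ (k + 1)

/-- The recursive form lets the types of successive collisions match by definition; the closed form
is needed only to count powers of `ξ'`. -/
theorem initialOrder_eq (ℓ k : ℕ) : initialOrder ℓ k = k + ℓ := by
  induction ℓ generalizing k with
  | zero => rfl
  | succ ℓ ih => rw [initialOrder, ih]; omega

/-- Sequences of `ℓ` collisions that lead to a density matrix of order `k + 1`. -/
def History : ℕ → ℕ → Type
  | 0, _ => Unit
  | ℓ + 1, k => (Bool × Fin (k + 1)) × History ℓ (k + 1)

instance instFintypeHistory : ∀ ℓ k, Fintype (History ℓ k)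
  | 0, _ => inferInstanceAs (Fintype Unit)
  | ℓ + 1, k =>
    have := instFintypeHistory ℓ (k + 1)
    inferInstanceAs (Fintype ((Bool × Fin (k + 1)) × History ℓ (k + 1)))

theorem card_history (ℓ k : ℕ) :
    Fintype.card (History ℓ k) = 2 ^ ℓ * (k + 1).ascFactorial ℓ := by
  induction ℓ generalizing k with
  | zero => rfl
  | succ ℓ ih =>
    have h1 : Fintype.card (History (ℓ + 1) k) =
        Fintype.card ((Bool × Fin (k + 1)) × History ℓ (k + 1)) := rfl
    rw [h1, Fintype.card_prod, Fintype.card_prod, ih, Fintype.card_bool, Fintype.card_fin,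
      Nat.ascFactorial_succ, ← Nat.succ_ascFactorial]
    ring

/-- Dividing the rising factorial by `ℓ!` leaves a binomial coefficient, at most `2 ^ (k + ℓ)`. -/
theorem card_history_le (ℓ k : ℕ) :
    (Fintype.card (History ℓ k) : ℝ) / ℓ.factorial ≤ 2 ^ k * 4 ^ ℓ := by
  rw [div_le_iff₀ (by positivity), card_history, Nat.ascFactorial_eq_factorial_mul_choose]
  have h1 : ((k + ℓ).choose ℓ : ℝ) ≤ 2 ^ (k + ℓ) := mod_cast Nat.choose_le_two_pow _ _
  push_cast
  calc (2 : ℝ) ^ ℓ * (ℓ.factorial * ((k + ℓ).choose ℓ : ℝ))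
      ≤ 2 ^ ℓ * (ℓ.factorial * 2 ^ (k + ℓ)) := by gcongr
    _ = 2 ^ k * 4 ^ ℓ * ℓ.factorial := by
      rw [pow_add, show (4 : ℝ) = 2 * 2 by norm_num, mul_pow]
      ring

/-- The map from frequencies of the initial to frequencies of the final density matrix. -/
def historyMap : ∀ ℓ k, History ℓ k → Config (initialOrder ℓ k + 1) → Config (k + 1)
  | 0, _, _ => id
  | ℓ + 1, k, (p, μ) => contract p.1 p.2 ∘ historyMap ℓ (k + 1) μ

theorem weight_historyMap_le {α : ℝ} (hα : 0 ≤ α) : ∀ (ℓ k : ℕ) (μ : History ℓ k)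
    (F : Config (initialOrder ℓ k + 1)),
    weight α (historyMap ℓ k μ F) ≤ (2 ^ α) ^ ℓ * weight α F
  | 0, _, _, F => by
    rw [pow_zero, one_mul]
    exact le_rfl
  | ℓ + 1, k, (p, μ), F => by
    refine (weight_contract_le hα p.1 p.2 (historyMap ℓ (k + 1) μ F)).trans ?_
    rw [pow_succ', mul_assoc]
    exact mul_le_mul_of_nonneg_left (weight_historyMap_le hα ℓ (k + 1) μ F) (by positivity)

/-- The sign with which a collision enters the collision operator. -/
def collisionParity : Bool → ℂ
  | true => 1
  | false => -1

/-- Coefficients of the term of the Duhamel expansion that belongs to a collision history. -/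
def historyCurve (b : ∀ n, lp (fun _ : NRConfig (n + 1) => ℂ) 2) :
    ∀ ℓ k, History ℓ k → ℝ → lp (fun _ : NRConfig (initialOrder ℓ k + 1) => ℂ) 2
  | 0, k, _, t => phaseMul id t (b k)
  | ℓ + 1, k, (p, μ), t => (-Complex.I * collisionParity p.1) •
      ∫ r in (0 : ℝ)..t, phaseMul (contract p.1 p.2 ∘ historyMap ℓ (k + 1) μ) (t - r)
        (historyCurve b ℓ (k + 1) μ r)

theorem norm_neg_I_mul_collisionParity (s : Bool) : ‖-Complex.I * collisionParity s‖ = 1 := by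
  cases s <;> simp [collisionParity]

theorem continuous_historyCurve (b : ∀ n, lp (fun _ : NRConfig (n + 1) => ℂ) 2) :
    ∀ (ℓ k : ℕ) (μ : History ℓ k), Continuous (historyCurve b ℓ k μ)
  | 0, k, _ => continuous_phaseMul_apply id (b k)
  | ℓ + 1, k, (p, μ) => by
    have hc := continuous_historyCurve b ℓ (k + 1) μ
    set R := contract p.1 p.2 ∘ historyMap ℓ (k + 1) μ with hR
    -- Splitting the evolution by `t - r` into those by `t` and `-r` frees the integrand of `t`, so
    -- the integral becomes a primitive.
    have hi : Continuous fun r => phaseMul R (-r) (historyCurve b ℓ (k + 1) μ r) :=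
      continuous_phaseMul R continuous_neg hc
    have h1 : Continuous fun t : ℝ => ∫ r in (0 : ℝ)..t,
        phaseMul R (-r) (historyCurve b ℓ (k + 1) μ r) :=
      intervalIntegral.continuous_primitive (μ := volume)
        (fun x y => hi.intervalIntegrable x y) 0
    have h2 := (continuous_phaseMul R continuous_id h1).const_smul
      (-Complex.I * collisionParity p.1)
    refine h2.congr fun t => ?_
    rw [historyCurve, Pi.smul_apply]
    congr 1
    simp only [← hR, id, phaseMul_sub R t]
    exact ((phaseMul R t).intervalIntegral_comp_comm (μ := volume)
      (hi.intervalIntegrable 0 t)).symm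

/-- The phases do not increase the norm, so each collision only integrates the previous bound in
time; iteration gives the volume of the time simplex. -/
theorem norm_historyCurve_le (b : ∀ n, lp (fun _ : NRConfig (n + 1) => ℂ) 2) :
    ∀ (ℓ k : ℕ) (μ : History ℓ k) {t : ℝ}, 0 ≤ t →
      ‖historyCurve b ℓ k μ t‖ ≤ t ^ ℓ / ℓ.factorial * ‖b (initialOrder ℓ k)‖
  | 0, k, _, t, _ => by
    have h1 := norm_phaseMul_le id t (b k)
    rw [pow_zero, Nat.factorial_zero, Nat.cast_one, div_one, one_mul]
    exact h1
  | ℓ + 1, k, (p, μ), t, ht => by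
    rw [historyCurve, norm_smul, norm_neg_I_mul_collisionParity, one_mul]
    set B := ‖b (initialOrder (ℓ + 1) k)‖ with hB
    have hint : ∫ r in (0 : ℝ)..t, r ^ ℓ / ℓ.factorial * B =
        t ^ (ℓ + 1) / (ℓ + 1).factorial * B := by
      rw [intervalIntegral.integral_mul_const, intervalIntegral.integral_div, integral_pow,
        Nat.factorial_succ]
      push_cast
      field_simp
      simp
    rw [← hint]
    refine intervalIntegral.norm_integral_le_of_norm_le ht (.of_forall fun r hr => ?_)
      ((by fun_prop : Continuous fun r : ℝ => r ^ ℓ / ℓ.factorial * B).intervalIntegrable _ _)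
    exact (norm_phaseMul_le _ _ _).trans (norm_historyCurve_le b ℓ (k + 1) μ hr.1.le)

/-! ### Summation over all histories -/

/-- Collision histories of arbitrary length. -/
abbrev Histories (k : ℕ) : Type := Σ ℓ, History ℓ k

/-- Appending a collision to a history. -/
def historiesEquiv (k : ℕ) : Unit ⊕ ((Bool × Fin (k + 1)) × Histories (k + 1)) ≃ Histories k where
  toFun
    | .inl _ => ⟨0, ()⟩
    | .inr (p, ⟨ℓ, μ⟩) => ⟨ℓ + 1, (p, μ)⟩
  invFun
    | ⟨0, _⟩ => .inl ()
    | ⟨ℓ + 1, (p, μ)⟩ => .inr (p, ⟨ℓ, μ⟩)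
  left_inv i := by
    rcases i with _ | ⟨p, ℓ, μ⟩ <;> rfl
  right_inv i := by
    rcases i with ⟨_ | ℓ, μ⟩ <;> rfl

/-- The bound for the contribution of a history to the `H^α` norm. -/
def majorant (κ T : ℝ) (b : ∀ n, lp (fun _ : NRConfig (n + 1) => ℂ) 2) {k : ℕ}
    (i : Histories k) : ℝ :=
  κ ^ i.1 * (T ^ i.1 / i.1.factorial * ‖b (initialOrder i.1 k)‖)

theorem majorant_nonneg {κ T : ℝ} (hκ : 0 ≤ κ) (hT : 0 ≤ T)
    (b : ∀ n, lp (fun _ : NRConfig (n + 1) => ℂ) 2) {k : ℕ} (i : Histories k) :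
    0 ≤ majorant κ T b i := by
  unfold majorant
  positivity

theorem tsum_majorant_le {κ T ξ' H : ℝ} (hκ : 0 ≤ κ) (hT : 0 ≤ T) (hξ' : 0 < ξ')
    (hκT : 8 * κ * T / ξ' ≤ 1) {b : ∀ n, lp (fun _ : NRConfig (n + 1) => ℂ) 2}
    (hb : ∀ n, ξ' ^ (n + 1) * ‖b n‖ ≤ H) (k : ℕ) :
    ∑' i : Histories k, ENNReal.ofReal (majorant κ T b i) ≤
      ENNReal.ofReal (2 ^ (k + 1) * H / ξ' ^ (k + 1)) := by
  have hH : 0 ≤ H := le_trans (by positivity) (hb 0)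
  have hterm : ∀ ℓ, ∑' μ : History ℓ k, ENNReal.ofReal (majorant κ T b ⟨ℓ, μ⟩) ≤
      ENNReal.ofReal (2 ^ k * H / ξ' ^ (k + 1) * (1 / 2) ^ ℓ) := by
    intro ℓ
    have hconst : ∀ μ : History ℓ k, majorant κ T b ⟨ℓ, μ⟩ =
        κ ^ ℓ * (T ^ ℓ / ℓ.factorial * ‖b (initialOrder ℓ k)‖) := fun _ => rfl
    simp only [hconst]
    rw [tsum_fintype, Finset.sum_const, Finset.card_univ, nsmul_eq_mul, ← ENNReal.ofReal_natCast,
      ← ENNReal.ofReal_mul (by positivity)]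
    refine ENNReal.ofReal_le_ofReal ?_
    have h1 : ‖b (initialOrder ℓ k)‖ ≤ H / ξ' ^ (k + ℓ + 1) := by
      rw [le_div_iff₀ (by positivity), initialOrder_eq, mul_comm]
      exact hb _
    -- The ratio combines `4` from counting histories, `κ` from the weights, `T` from time and one
    -- power of `ξ'` per collision. The constant `8` makes it at most one half.
    have h2 : (4 * κ * T / ξ') ^ ℓ ≤ (1 / 2) ^ ℓ := by
      refine pow_le_pow_left₀ (by positivity) ?_ ℓ
      have : 8 * κ * T / ξ' = 2 * (4 * κ * T / ξ') := by ring
      linarith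
    calc (Fintype.card (History ℓ k) : ℝ) *
          (κ ^ ℓ * (T ^ ℓ / ℓ.factorial * ‖b (initialOrder ℓ k)‖))
        = (Fintype.card (History ℓ k) / ℓ.factorial) *
            (κ ^ ℓ * T ^ ℓ * ‖b (initialOrder ℓ k)‖) := by
          ring
      _ ≤ (2 ^ k * 4 ^ ℓ) * (κ ^ ℓ * T ^ ℓ * (H / ξ' ^ (k + ℓ + 1))) := by
          gcongr
          exact card_history_le ℓ k
      _ = 2 ^ k * H / ξ' ^ (k + 1) * (4 * κ * T / ξ') ^ ℓ := by
          rw [div_pow, mul_pow, mul_pow, show k + ℓ + 1 = (k + 1) + ℓ by ring, pow_add]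
          field_simp
      _ ≤ _ := mul_le_mul_of_nonneg_left h2 (by positivity)
  rw [ENNReal.tsum_sigma']
  refine (ENNReal.tsum_le_tsum hterm).trans ?_
  rw [← ENNReal.ofReal_tsum_of_nonneg (fun ℓ => by positivity)
    (summable_geometric_two.mul_left _), tsum_mul_left, tsum_geometric_two]
  refine ENNReal.ofReal_le_ofReal (le_of_eq ?_)
  ring

theorem summable_majorant {κ T ξ' H : ℝ} (hκ : 0 ≤ κ) (hT : 0 ≤ T) (hξ' : 0 < ξ')
    (hκT : 8 * κ * T / ξ' ≤ 1) {b : ∀ n, lp (fun _ : NRConfig (n + 1) => ℂ) 2}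
    (hb : ∀ n, ξ' ^ (n + 1) * ‖b n‖ ≤ H) (k : ℕ) :
    Summable fun i : Histories k => majorant κ T b i := by
  have h := ((tsum_majorant_le hκ hT hξ' hκT hb k).trans_lt ENNReal.ofReal_lt_top).ne
  have h1 := ENNReal.summable_toReal h
  simpa [ENNReal.toReal_ofReal (majorant_nonneg hκ hT b _)] using h1

theorem tsum_tsum_majorant_le {κ T ξ ξ' H : ℝ} (hκ : 0 ≤ κ) (hT : 0 ≤ T) (hξ : 0 < ξ)
    (hξ' : 0 < ξ') (hκT : 8 * κ * T / ξ' ≤ 1) (hξξ' : 4 * ξ / ξ' ≤ 1)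
    {b : ∀ n, lp (fun _ : NRConfig (n + 1) => ℂ) 2} (hb : ∀ n, ξ' ^ (n + 1) * ‖b n‖ ≤ H) :
    ∑' (k : ℕ) (i : Histories k), ENNReal.ofReal (ξ ^ (k + 1) * majorant κ T b i) ≤
      ENNReal.ofReal (4 * H) := by
  have hH : 0 ≤ H := le_trans (by positivity) (hb 0)
  have hterm : ∀ k : ℕ, ∑' i : Histories k, ENNReal.ofReal (ξ ^ (k + 1) * majorant κ T b i) ≤
      ENNReal.ofReal (2 * H * (1 / 2) ^ k) := by
    intro k
    simp only [ENNReal.ofReal_mul (pow_nonneg hξ.le (k + 1))]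
    rw [ENNReal.tsum_mul_left]
    refine (mul_le_mul_right (tsum_majorant_le hκ hT hξ' hκT hb k) _).trans ?_
    rw [← ENNReal.ofReal_mul (by positivity)]
    refine ENNReal.ofReal_le_ofReal ?_
    -- The `2` stems from the binomial bound; `4` in the hypothesis again leaves ratio one half.
    have h1 : (2 * ξ / ξ') ^ (k + 1) ≤ (1 / 2) ^ (k + 1) := by
      refine pow_le_pow_left₀ (by positivity) ?_ _
      have : 4 * ξ / ξ' = 2 * (2 * ξ / ξ') := by ring
      linarith
    calc ξ ^ (k + 1) * (2 ^ (k + 1) * H / ξ' ^ (k + 1)) = H * (2 * ξ / ξ') ^ (k + 1) := by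
          rw [div_pow, mul_pow]
          ring
      _ ≤ H * (1 / 2) ^ (k + 1) := mul_le_mul_of_nonneg_left h1 hH
      _ ≤ 2 * H * (1 / 2) ^ k := by
          rw [pow_succ]
          have : 0 ≤ H * (1 / 2) ^ k := by positivity
          linarith
  refine (ENNReal.tsum_le_tsum hterm).trans ?_
  rw [← ENNReal.ofReal_tsum_of_nonneg (fun ℓ => by positivity)
    (summable_geometric_two.mul_left _), tsum_mul_left, tsum_geometric_two]
  refine ENNReal.ofReal_le_ofReal (le_of_eq ?_)
  ring

/-! ### Weighted Fourier coefficients -/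

theorem sobolevNorm_mono {α β : ℝ} (h : α ≤ β) {k : ℕ} (σ : DensityMatrix k) :
    sobolevNorm α σ ≤ sobolevNorm β σ := by
  unfold sobolevNorm
  refine ENNReal.rpow_le_rpow (ENNReal.tsum_le_tsum fun p => ?_) (by norm_num)
  refine pow_le_pow_left' ?_ 2
  gcongr
  exact sobolevWeight_mono h _ _

theorem hierarchyNorm_mono {α β : ℝ} (h : α ≤ β) (ξ : ℝ) (S : Hierarchy) :
    hierarchyNorm α ξ S ≤ hierarchyNorm β ξ S := by
  unfold hierarchyNorm
  exact ENNReal.tsum_le_tsum fun k => by gcongr; exact sobolevNorm_mono h _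

/-- The weighted coefficients lie in `ℓ²` with norm controlled by the `H^α` norm, so all later
estimates are plain `ℓ²` estimates. -/
theorem exists_weighted_coef {α : ℝ} (hα : 0 ≤ α) {n : ℕ} (σ : DensityMatrix n)
    (hσ : sobolevNorm α σ < ∞) : ∃ b : lp (fun _ : NRConfig n => ℂ) 2,
      (∀ F, unweight hα n b F = fourierCoef σ F.1.1 F.1.2) ∧ ‖b‖ₑ ≤ sobolevNorm α σ := by
  have hw : ∀ X : Config n, 0 < weight α X := fun X =>
    zero_lt_one.trans_le (one_le_sobolevWeight hα X.1 X.2)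
  have hfin : ∑' p : Config n,
      (ENNReal.ofReal (weight α p) * ‖fourierCoef σ p.1 p.2‖ₑ) ^ 2 ≠ ∞ := by
    intro h
    rw [sobolevNorm, h] at hσ
    simp at hσ
  let c : NRConfig n → ℂ := fun F => (weight α F.1 : ℂ) * fourierCoef σ F.1.1 F.1.2
  have hc : ∀ F, ‖c F‖ₑ = ENNReal.ofReal (weight α F.1) * ‖fourierCoef σ F.1.1 F.1.2‖ₑ := by
    intro F
    rw [enorm_mul, ← ofReal_norm, Complex.norm_real, Real.norm_of_nonneg (hw _).le]
  have hle : ∑' F : NRConfig n, ‖c F‖ₑ ^ 2 ≤ ∑' p : Config n,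
      (ENNReal.ofReal (weight α p) * ‖fourierCoef σ p.1 p.2‖ₑ) ^ 2 := by
    simp only [hc]
    exact ENNReal.tsum_comp_le_tsum_of_injective Subtype.val_injective _
  have hmem : Memℓp c 2 := by
    rw [memℓp_gen_iff (by norm_num)]
    have := ENNReal.summable_toReal (ne_top_of_le_ne_top hfin hle)
    simpa using this
  refine ⟨⟨c, hmem⟩, fun F => ?_, ?_⟩
  · rw [unweight, diagMul_apply]
    change _ * ((weight α F.1 : ℂ) * fourierCoef σ F.1.1 F.1.2) = _
    rw [← mul_assoc, ← Complex.ofReal_mul, inv_mul_cancel₀ (hw _).ne']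
    simp
  · rw [sobolevNorm, one_div, ENNReal.le_rpow_inv_iff (by norm_num), ENNReal.rpow_two,
      lp_two_enorm_sq]
    exact hle

/-! ### The solution -/

section Solution

variable {Ω : Type*} [MeasurableSpace Ω] {P : Measure Ω} [IsProbabilityMeasure P]
  {h : Freq → Ω → ℝ} (hh : IsBernoulliFamily P h) {α : ℝ} (hα : 0 ≤ α)
  (b : ∀ n, lp (fun _ : NRConfig (n + 1) => ℂ) 2)

theorem norm_unweight_le (n : ℕ) (f : lp (fun _ : NRConfig n => ℂ) 2) :
    ‖unweight hα n f‖ ≤ ‖f‖ := norm_diagMul_le _ _ f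

theorem phaseMul_unweight {n k : ℕ} (R : Config n → Config k) (t : ℝ)
    (f : lp (fun _ : NRConfig n => ℂ) 2) :
    phaseMul R t (unweight hα n f) = unweight hα n (phaseMul R t f) := by
  ext F
  simp only [phaseMul, unweight, diagMul_apply]
  ring

/-- The term of the Duhamel expansion that belongs to a collision history. -/
def historyTerm {k : ℕ} (i : Histories k) (t : ℝ) : RandomDensityMatrix P (k + 1) :=
  synth hh (historyMap i.1 k i.2) (unweight hα _ (historyCurve b i.1 k i.2 t))

/-- The sum of the Duhamel expansion. -/
def duhamelSeries (t : ℝ) : RandomHierarchy P := fun _ => ∑' i, historyTerm hh hα b i t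

/-- The image of a term of the Duhamel expansion under a collision and the free evolution. -/
def collidedTerm {k : ℕ} (p : Bool × Fin (k + 1)) (i : Histories (k + 1)) (t r : ℝ) :
    RandomDensityMatrix P (k + 1) :=
  synth hh (contract p.1 p.2 ∘ historyMap i.1 (k + 1) i.2) (unweight hα _
    (phaseMul (contract p.1 p.2 ∘ historyMap i.1 (k + 1) i.2) (t - r)
      (historyCurve b i.1 (k + 1) i.2 r)))

/-- The value `κ = 1` governs convergence in `L²(Ω; L²)`, where no weight is lost; `κ = 2 ^ α` is
reserved for the Sobolev norm. -/
theorem norm_historyCurve_le_majorant {k : ℕ} {T t : ℝ} (ht : t ∈ Set.Icc 0 T)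
    (i : Histories k) : ‖historyCurve b i.1 k i.2 t‖ ≤ majorant 1 T b i := by
  refine (norm_historyCurve_le b i.1 k i.2 ht.1).trans ?_
  rw [majorant, one_pow, one_mul]
  have := pow_le_pow_left₀ ht.1 ht.2 i.1
  gcongr

theorem randomSobolevNorm_synth_historyMap_le {k : ℕ} (i : Histories k)
    (f : lp (fun _ : NRConfig (initialOrder i.1 k + 1) => ℂ) 2) :
    randomSobolevNorm α (synth hh (historyMap i.1 k i.2) (unweight hα _ f)) ≤
      ENNReal.ofReal ((2 ^ α) ^ i.1 * ‖f‖) := by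
  rw [ENNReal.ofReal_mul (by positivity), ofReal_norm]
  exact randomSobolevNorm_synth_unweight_le hh hα _
    (fun F => weight_historyMap_le hα i.1 k i.2 F) f

variable {b} {T : ℝ} (hS : ∀ k, Summable fun i : Histories k => majorant 1 T b i)
include hS

theorem summable_norm_historyCurve {k : ℕ} {t : ℝ} (ht : t ∈ Set.Icc 0 T) :
    Summable fun i : Histories k => ‖historyCurve b i.1 k i.2 t‖ :=
  (hS k).of_nonneg_of_le (fun _ => norm_nonneg _) (norm_historyCurve_le_majorant b ht)

theorem summable_historyTerm {k : ℕ} {t : ℝ} (ht : t ∈ Set.Icc 0 T) :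
    Summable fun i : Histories k => historyTerm hh hα b i t := by
  refine Summable.of_norm_bounded (summable_norm_historyCurve hS ht) fun i => ?_
  rw [historyTerm, LinearIsometry.norm_map]
  exact norm_unweight_le hα _ _

omit hS in
theorem norm_collidedTerm_le {k : ℕ} (p : Bool × Fin (k + 1)) (i : Histories (k + 1)) (t : ℝ)
    {r : ℝ} (hr : r ∈ Set.Icc 0 T) : ‖collidedTerm hh hα b p i t r‖ ≤ majorant 1 T b i := by
  rw [collidedTerm, LinearIsometry.norm_map]
  exact ((norm_unweight_le hα _ _).trans (norm_phaseMul_le _ _ _)).trans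
    (norm_historyCurve_le_majorant b hr i)

theorem collision_duhamelSeries {t : ℝ} (ht : t ∈ Set.Icc 0 T) (k : ℕ) :
    CollisionDefined h (duhamelSeries hh hα b t (k + 1)) ∧
      collision h (duhamelSeries hh hα b t (k + 1)) =
        ∑ p : Bool × Fin (k + 1), collisionParity p.1 • ∑' i : Histories (k + 1),
          synth hh (contract p.1 p.2 ∘ historyMap i.1 (k + 1) i.2)
            (unweight hα _ (historyCurve b i.1 (k + 1) i.2 t)) := by
  have hf : Summable fun i : Histories (k + 1) =>
      ‖unweight hα _ (historyCurve b i.1 (k + 1) i.2 t)‖ :=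
    (summable_norm_historyCurve hS ht).of_nonneg_of_le (fun _ => norm_nonneg _) fun i =>
      norm_unweight_le hα _ _
  have hs := fun (s : Bool) (j : Fin (k + 1)) => hasSum_collisionTermL hh s j
    (fun i : Histories (k + 1) => historyMap i.1 (k + 1) i.2)
    (fun i => unweight hα _ (historyCurve b i.1 (k + 1) i.2 t)) hf
  have hplus := fun j => collisionPlus_eq hh j (hs true j)
  have hminus := fun j => collisionMinus_eq hh j (hs false j)
  refine ⟨fun j => ⟨(hplus j).1, (hminus j).1⟩, ?_⟩
  rw [Fintype.sum_prod_type, Fintype.sum_bool, collision, Finset.sum_sub_distrib, sub_eq_add_neg,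
    ← Finset.sum_neg_distrib]
  congr 1
  · refine Finset.sum_congr rfl fun j _ => ?_
    rw [collisionParity, one_smul]
    exact (hplus j).2
  · refine Finset.sum_congr rfl fun j _ => ?_
    rw [collisionParity, neg_one_smul]
    exact congrArg _ (hminus j).2

theorem duhamelIntegrand_duhamelSeries {r : ℝ} (hr : r ∈ Set.Icc 0 T) (t : ℝ) (k : ℕ) :
    duhamelIntegrand h (duhamelSeries hh hα b) t k r =
      ∑ p : Bool × Fin (k + 1), collisionParity p.1 •
        ∑' i : Histories (k + 1), collidedTerm hh hα b p i t r := by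
  have hL : ∀ θ : RandomDensityMatrix P (k + 1), (freeEvolution (k + 1) (t - r)).compLp θ =
      (freeEvolution (k + 1) (t - r)).compLpL 2 P θ := fun _ => rfl
  rw [duhamelIntegrand, (collision_duhamelSeries hh hα hS hr k).2, hL, map_sum]
  refine Finset.sum_congr rfl fun p _ => ?_
  rw [map_smul]
  congr 1
  have hs : Summable fun i : Histories (k + 1) =>
      synth hh (contract p.1 p.2 ∘ historyMap i.1 (k + 1) i.2)
        (unweight hα _ (historyCurve b i.1 (k + 1) i.2 r)) := by
    refine Summable.of_norm_bounded (summable_norm_historyCurve hS hr) fun i => ?_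
    rw [LinearIsometry.norm_map]
    exact norm_unweight_le hα _ _
  rw [ContinuousLinearMap.map_tsum _ hs]
  refine tsum_congr fun i => ?_
  rw [← hL, freeEvolution_synth, phaseMul_unweight]
  rfl

omit hS in
theorem continuous_collidedTerm {k : ℕ} (p : Bool × Fin (k + 1)) (i : Histories (k + 1))
    (t : ℝ) : Continuous (collidedTerm hh hα b p i t) :=
  (synth hh _).continuous.comp ((unweight hα _).continuous.comp
    (continuous_phaseMul _ (by fun_prop) (continuous_historyCurve b i.1 (k + 1) i.2)))

theorem continuousOn_tsum_collidedTerm {k : ℕ} (p : Bool × Fin (k + 1)) (t : ℝ) :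
    ContinuousOn (fun r => ∑' i : Histories (k + 1), collidedTerm hh hα b p i t r)
      (Set.Icc 0 T) :=
  continuousOn_tsum (fun i => (continuous_collidedTerm hh hα p i t).continuousOn) (hS (k + 1))
    fun i _ hr => norm_collidedTerm_le hh hα p i t hr

theorem intervalIntegrable_duhamelIntegrand {t : ℝ} (ht : t ∈ Set.Icc 0 T) (k : ℕ) :
    IntervalIntegrable (duhamelIntegrand h (duhamelSeries hh hα b) t k) volume 0 t := by
  refine ContinuousOn.intervalIntegrable ?_
  rw [Set.uIcc_of_le ht.1]
  have hsub : Set.Icc 0 t ⊆ Set.Icc 0 T := Set.Icc_subset_Icc_right ht.2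
  have hc : ContinuousOn (fun r => ∑ p : Bool × Fin (k + 1), collisionParity p.1 •
      ∑' i : Histories (k + 1), collidedTerm hh hα b p i t r) (Set.Icc 0 T) :=
    continuousOn_finsetSum _ fun p _ =>
      (continuousOn_tsum_collidedTerm hh hα hS p t).fun_const_smul _
  exact (hc.congr fun r hr => duhamelIntegrand_duhamelSeries hh hα hS hr t k).mono hsub

omit hS in
-- Integrating a collided term in time is the recursion step that defines the history with one more
-- collision; the bounded operators pass through the integral.
theorem smul_integral_collidedTerm {k : ℕ} (p : Bool × Fin (k + 1)) (i : Histories (k + 1))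
    (t : ℝ) : (-Complex.I * collisionParity p.1) • ∫ r in (0 : ℝ)..t, collidedTerm hh hα b p i t r =
      historyTerm hh hα b (historiesEquiv k (.inr (p, i))) t := by
  obtain ⟨ℓ, μ⟩ := i
  let L := (synth hh (contract p.1 p.2 ∘ historyMap ℓ (k + 1) μ)).toContinuousLinearMap.comp
    (unweight hα _)
  have hi : IntervalIntegrable (fun r => phaseMul (contract p.1 p.2 ∘ historyMap ℓ (k + 1) μ)
      (t - r) (historyCurve b ℓ (k + 1) μ r)) volume 0 t :=
    (continuous_phaseMul _ (by fun_prop) (continuous_historyCurve b ℓ (k + 1) μ)).intervalIntegrable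
      _ _
  have h1 := L.intervalIntegral_comp_comm hi
  refine (congrArg _ h1).trans ?_
  rw [← map_smul]
  rfl

theorem hasSum_integral_collidedTerm {k : ℕ} (p : Bool × Fin (k + 1)) {t : ℝ}
    (ht : t ∈ Set.Icc 0 T) :
    HasSum (fun i : Histories (k + 1) => ∫ r in (0 : ℝ)..t, collidedTerm hh hα b p i t r)
      (∫ r in (0 : ℝ)..t, ∑' i : Histories (k + 1), collidedTerm hh hα b p i t r) := by
  have hmem : ∀ r ∈ Set.uIoc 0 t, r ∈ Set.Icc 0 T := fun r hr => by
    rw [Set.uIoc_of_le ht.1] at hr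
    exact ⟨hr.1.le, hr.2.trans ht.2⟩
  refine intervalIntegral.hasSum_integral_of_dominated_convergence
    (fun i _ => majorant 1 T b i)
    (fun i => (continuous_collidedTerm hh hα p i t).aestronglyMeasurable)
    (fun i => .of_forall fun r hr => norm_collidedTerm_le hh hα p i t (hmem r hr))
    (.of_forall fun _ _ => hS (k + 1)) intervalIntegrable_const
    (.of_forall fun r hr => Summable.hasSum ?_)
  exact Summable.of_norm_bounded (hS (k + 1)) fun i =>
    norm_collidedTerm_le hh hα p i t (hmem r hr)

/-- A history is either empty, giving the free evolution of the data, or has a latest collision `p`.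
The histories with given `p` sum to the time integral of the collided series. -/
theorem duhamelSeries_eq {t : ℝ} (ht : t ∈ Set.Icc 0 T) (k : ℕ) :
    duhamelSeries hh hα b t k = synth hh id (unweight hα _ (phaseMul id t (b k))) -
      Complex.I • ∫ r in (0 : ℝ)..t, duhamelIntegrand h (duhamelSeries hh hα b) t k r := by
  have h1 : ∫ r in (0 : ℝ)..t, duhamelIntegrand h (duhamelSeries hh hα b) t k r =
      ∑ p : Bool × Fin (k + 1), collisionParity p.1 • ∫ r in (0 : ℝ)..t,
        ∑' i : Histories (k + 1), collidedTerm hh hα b p i t r := by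
    have hsub : Set.uIcc 0 t ⊆ Set.Icc 0 T := by
      rw [Set.uIcc_of_le ht.1]
      exact Set.Icc_subset_Icc_right ht.2
    rw [intervalIntegral.integral_congr fun r hr =>
      duhamelIntegrand_duhamelSeries hh hα hS (hsub hr) t k, intervalIntegral.integral_finsetSum]
    · exact Finset.sum_congr rfl fun p _ => intervalIntegral.integral_smul _ _
    · exact fun p _ => (((continuousOn_tsum_collidedTerm hh hα hS p t).mono hsub).fun_const_smul
        _).intervalIntegrable
  have h2 : ∀ p : Bool × Fin (k + 1), HasSum
      (fun i : Histories (k + 1) => historyTerm hh hα b (historiesEquiv k (.inr (p, i))) t)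
      ((-Complex.I * collisionParity p.1) • ∫ r in (0 : ℝ)..t,
        ∑' i : Histories (k + 1), collidedTerm hh hα b p i t r) := fun p => by
    simp only [← smul_integral_collidedTerm]
    exact (hasSum_integral_collidedTerm hh hα hS p ht).const_smul _
  have hs := (historiesEquiv k).summable_iff.2 (summable_historyTerm hh hα hS (k := k) ht)
  have hr := hs.comp_injective Sum.inr_injective
  rw [duhamelSeries, ← (historiesEquiv k).tsum_eq, h1, Finset.smul_sum]
  refine ((hs.comp_injective Sum.inl_injective).tsum_sum hr).trans ?_
  rw [sub_eq_add_neg, ← Finset.sum_neg_distrib]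
  congr 1
  · exact (hasSum_unique _).tsum_eq
  · refine hr.tsum_prod.trans ?_
    rw [tsum_fintype]
    refine Finset.sum_congr rfl fun p _ => (h2 p).tsum_eq.trans ?_
    rw [neg_mul, neg_smul, mul_smul]

theorem randomHierarchyNorm_duhamelSeries_le {ξ : ℝ} (hξ : 0 < ξ) {t : ℝ}
    (ht : t ∈ Set.Icc 0 T) :
    randomHierarchyNorm α ξ (duhamelSeries hh hα b t) ≤
      ∑' (k : ℕ) (i : Histories k), ENNReal.ofReal (ξ ^ (k + 1) * majorant (2 ^ α) T b i) := by
  refine ENNReal.tsum_le_tsum fun k => ?_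
  simp only [ENNReal.ofReal_mul (pow_nonneg hξ.le (k + 1))]
  rw [ENNReal.tsum_mul_left]
  gcongr
  refine (randomSobolevNorm_le_tsum α (summable_historyTerm hh hα hS ht).hasSum).trans ?_
  refine ENNReal.tsum_le_tsum fun i => ?_
  refine (randomSobolevNorm_synth_historyMap_le hh hα i _).trans (ENNReal.ofReal_le_ofReal ?_)
  have := norm_historyCurve_le_majorant b ht i
  rw [majorant, one_pow, one_mul] at this
  rw [majorant]
  gcongr

/-- Every history curve is continuous in `ℓ²`, and the summable majorant allows dominated
convergence over all orders and histories at once. -/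
theorem continuousInTime_duhamelSeries {ξ : ℝ} (hξ : 0 < ξ)
    (hfin : ∑' (k : ℕ) (i : Histories k),
      ENNReal.ofReal (ξ ^ (k + 1) * majorant (2 ^ α) T b i) < ∞) :
    ContinuousInTime α ξ T (duhamelSeries hh hα b) := by
  intro t ht
  refine ⟨(randomHierarchyNorm_duhamelSeries_le hh hα hS hξ ht).trans_lt hfin, ?_⟩
  let d : ℝ → (Σ k, Histories k) → ℝ := fun s x => ξ ^ (x.1 + 1) * ((2 ^ α) ^ x.2.1 *
    ‖historyCurve b x.2.1 x.1 x.2.2 s - historyCurve b x.2.1 x.1 x.2.2 t‖)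
  have hd0 : ∀ s x, 0 ≤ d s x := fun s x => by positivity
  have hsum : Summable fun x : Σ k, Histories k =>
      -- The factor `2` covers the curve at both times `s` and `t`.
      2 * (ξ ^ (x.1 + 1) * majorant (2 ^ α) T b x.2) := by
    refine Summable.mul_left 2 ?_
    rw [← ENNReal.tsum_sigma'
      (fun (x : Σ k, Histories k) => ENNReal.ofReal (ξ ^ (x.1 + 1) * majorant (2 ^ α) T b x.2))]
      at hfin
    have h1 := ENNReal.summable_toReal hfin.ne
    refine h1.congr fun x => (ENNReal.toReal_ofReal ?_)
    exact mul_nonneg (by positivity) (majorant_nonneg (by positivity) (ht.1.trans ht.2) b _)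
  have hdle : ∀ s ∈ Set.Icc 0 T, ∀ x, d s x ≤ 2 * (ξ ^ (x.1 + 1) * majorant (2 ^ α) T b x.2) := by
    intro s hs x
    have h1 := norm_historyCurve_le_majorant b hs x.2
    have h2 := norm_historyCurve_le_majorant b ht x.2
    have h3 := norm_sub_le (historyCurve b x.2.1 x.1 x.2.2 s) (historyCurve b x.2.1 x.1 x.2.2 t)
    simp only [majorant, one_pow, one_mul] at h1 h2
    calc d s x ≤ ξ ^ (x.1 + 1) * ((2 ^ α) ^ x.2.1 *
          (2 * (T ^ x.2.1 / x.2.1.factorial * ‖b (initialOrder x.2.1 x.1)‖))) := by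
          refine mul_le_mul_of_nonneg_left (mul_le_mul_of_nonneg_left ?_ (by positivity))
            (by positivity)
          linarith
      _ = _ := by
          rw [majorant]
          ring
  have hlim : Tendsto (fun s => ∑' x, d s x) (𝓝[Set.Icc 0 T] t) (𝓝 0) := by
    suffices h0 : Tendsto (fun s => ∑' x, d s x) (𝓝[Set.Icc 0 T] t)
        (𝓝 (∑' _ : Σ k, Histories k, (0 : ℝ))) by rwa [tsum_zero] at h0
    refine tendsto_tsum_of_dominated_convergence hsum (fun x => ?_) ?_
    · have h1 := tendsto_iff_norm_sub_tendsto_zero.1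
        ((continuous_historyCurve b x.2.1 x.1 x.2.2).tendsto t)
      have h2 := ((h1.const_mul ((2 ^ α) ^ x.2.1)).const_mul (ξ ^ (x.1 + 1)))
      rw [mul_zero, mul_zero] at h2
      exact h2.mono_left nhdsWithin_le_nhds
    · filter_upwards [self_mem_nhdsWithin] with s hs x
      rw [Real.norm_of_nonneg (hd0 s x)]
      exact hdle s hs x
  have hlim' := (ENNReal.continuous_ofReal.tendsto 0).comp hlim
  rw [ENNReal.ofReal_zero] at hlim'
  refine tendsto_of_tendsto_of_tendsto_of_le_of_le' tendsto_const_nhds hlim'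
    (.of_forall fun _ => zero_le) ?_
  filter_upwards [self_mem_nhdsWithin] with s hs
  have hds : Summable (d s) := hsum.of_nonneg_of_le (hd0 s) (hdle s hs)
  rw [Function.comp_apply, ENNReal.ofReal_tsum_of_nonneg (hd0 s) hds, ENNReal.tsum_sigma']
  refine ENNReal.tsum_le_tsum fun k => ?_
  have he : ∀ i : Histories k, ENNReal.ofReal (d s ⟨k, i⟩) = ENNReal.ofReal (ξ ^ (k + 1)) *
      ENNReal.ofReal ((2 ^ α) ^ i.1 *
        ‖historyCurve b i.1 k i.2 s - historyCurve b i.1 k i.2 t‖) := fun i =>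
    ENNReal.ofReal_mul (by positivity)
  simp only [he]
  rw [ENNReal.tsum_mul_left]
  gcongr
  have hsub := (summable_historyTerm hh hα hS (k := k) hs).hasSum.sub
    (summable_historyTerm hh hα hS (k := k) ht).hasSum
  refine (randomSobolevNorm_le_tsum α hsub).trans (ENNReal.tsum_le_tsum fun i => ?_)
  rw [historyTerm, historyTerm, ← map_sub, ← map_sub]
  exact randomSobolevNorm_synth_historyMap_le hh hα i _

end Solution

end GP

end

/-! ### The main theorem -/

theorem theorem4p19 (α α₀ : ℝ) (hα : 0 ≤ α) (hα₀ : α < α₀) :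
    ∃ C₁ C₂ : ℝ, 0 < C₁ ∧ 0 < C₂ ∧
      ∀ ξ ξ' : ℝ, 0 < ξ → ξ < ξ' → C₂ * ξ / ξ' < 1 →
        ∃ C : ℝ≥0, ∀ T : ℝ, 0 < T → C₁ * T / ξ' < 1 →
          ∀ (Ω : Type*) [MeasurableSpace Ω] (P : Measure Ω) [IsProbabilityMeasure P]
            (h : GP.Freq → Ω → ℝ), GP.IsBernoulliFamily P h →
          ∀ Γ₀ : GP.Hierarchy, GP.hierarchyNorm α₀ ξ' Γ₀ < ∞ → GP.Nonresonant α Γ₀ →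
            ∃ Γ : ℝ → GP.RandomHierarchy P,
              GP.ContinuousInTime α ξ T Γ ∧
              (∀ t ∈ Set.Icc 0 T, ∀ k : ℕ, GP.CollisionDefined h (Γ t (k + 1))) ∧
              (∀ t ∈ Set.Icc 0 T, ∀ k : ℕ,
                IntervalIntegrable (GP.duhamelIntegrand h Γ t k) volume 0 t) ∧
              (∀ t ∈ Set.Icc 0 T, ∀ ξ₀ : ℝ, 0 < ξ₀ →
                GP.randomHierarchyNorm α ξ₀ (GP.duhamelDefect h Γ₀ Γ t) = 0) ∧
              (∀ t ∈ Set.Icc 0 T, ∀ k : ℕ,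
                GP.randomSobolevNorm α (GP.duhamelDefect h Γ₀ Γ t k) = 0) ∧
              (⨆ t ∈ Set.Icc 0 T, GP.randomHierarchyNorm α ξ (Γ t)) ≤
                C * GP.hierarchyNorm α ξ' Γ₀ := by
  -- The first constant is `8 κ` with the weight loss `κ = 2 ^ α`; the second makes the sum over
  -- orders geometric, and the solution bound `4` is the resulting total of both series.
  refine ⟨8 * 2 ^ α, 4, by positivity, by norm_num, fun ξ ξ' hξ hξξ' hC₂ => ⟨4, ?_⟩⟩
  intro T hT hC₁ Ω _ P _ h hh Γ₀ hΓ₀ hN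
  have hξ' : 0 < ξ' := hξ.trans hξξ'
  have hfin : GP.hierarchyNorm α ξ' Γ₀ < ∞ := (GP.hierarchyNorm_mono hα₀.le ξ' Γ₀).trans_lt hΓ₀
  have hle : ∀ n, ENNReal.ofReal (ξ' ^ (n + 1)) * GP.sobolevNorm α (Γ₀ n) ≤
      GP.hierarchyNorm α ξ' Γ₀ := fun n => ENNReal.le_tsum n
  have hσ : ∀ n, GP.sobolevNorm α (Γ₀ n) < ∞ := fun n =>
    ENNReal.lt_top_of_mul_ne_top_right ((hle n).trans_lt hfin).ne
      (ENNReal.ofReal_pos.2 (by positivity)).ne'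
  choose b hb hbn using fun n => GP.exists_weighted_coef hα (Γ₀ n) (hσ n)
  set H := (GP.hierarchyNorm α ξ' Γ₀).toReal with hH
  have hbH : ∀ n, ξ' ^ (n + 1) * ‖b n‖ ≤ H := by
    intro n
    rw [hH, ← ENNReal.ofReal_le_iff_le_toReal hfin.ne, ENNReal.ofReal_mul (by positivity),
      ofReal_norm]
    exact (mul_le_mul_right (hbn n) _).trans (hle n)
  have h2α : (1 : ℝ) ≤ 2 ^ α := Real.one_le_rpow (by norm_num) hα
  -- Convergence without weights follows from the same smallness condition because `1 ≤ 2 ^ α`.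
  have hS : ∀ k, Summable fun i : GP.Histories k => GP.majorant 1 T b i := fun k => by
    refine GP.summable_majorant zero_le_one hT.le hξ' (le_trans ?_ hC₁.le) hbH k
    gcongr
  have htot := GP.tsum_tsum_majorant_le (by positivity) hT.le hξ hξ' hC₁.le hC₂.le hbH
  -- The defect vanishes as an element of `L²(Ω; L²)`, hence in the norm for every `ξ₀`.
  have hzero : ∀ t ∈ Set.Icc 0 T, ∀ k : ℕ,
      GP.duhamelDefect h Γ₀ (GP.duhamelSeries hh hα b) t k = 0 := by
    intro t ht k
    have h1 : Lp.const 2 P (GP.freeEvolution (k + 1) t (Γ₀ k)) =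
        GP.synth hh id (GP.unweight hα _ (GP.phaseMul id t (b k))) := by
      refine GP.const_eq_synth hh _ (fun X hX => ?_) _ fun F => ?_
      · rw [GP.fourierCoef_freeEvolution, hN.1 k X.1 X.2 hX, mul_zero]
      · rw [← GP.phaseMul_unweight, GP.fourierCoef_freeEvolution, ← hb k F]
        rfl
    rw [GP.duhamelDefect, h1, GP.duhamelSeries_eq hh hα hS ht k]
    abel
  refine ⟨GP.duhamelSeries hh hα b,
    GP.continuousInTime_duhamelSeries hh hα hS hξ (htot.trans_lt ENNReal.ofReal_lt_top),
    fun t ht k => (GP.collision_duhamelSeries hh hα hS ht k).1,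
    fun t ht k => GP.intervalIntegrable_duhamelIntegrand hh hα hS ht k,
    fun t ht ξ₀ _ => ?_, fun t ht k => ?_, ?_⟩
  · simp [GP.randomHierarchyNorm, hzero t ht, GP.randomSobolevNorm_zero]
  · rw [hzero t ht k, GP.randomSobolevNorm_zero]
  · refine iSup₂_le fun t ht =>
      (GP.randomHierarchyNorm_duhamelSeries_le hh hα hS hξ ht).trans (htot.trans ?_)
    rw [ENNReal.ofReal_mul (by norm_num), hH, ENNReal.ofReal_toReal hfin.ne]
    norm_num
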